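/- Let $n\ge 0$ and let $u$ be a standard Young tableau with entries $1,\dots,n$ whose shape $\mu$ has at most two rows; let $p_1<\dots<p_k$ be the entries of its second row ($k=0$ if there is none). For a set $I\subset\{1,\dots,n\}$ put $x_I=\prod_{i\in I}x_i$. Let $A_{n,k}=\{\sum_{|I|=k}c_Ix_I : c_I\in\mathbb C\}$ be the space of square-free forms of degree $k$ in $x_1,\dots,x_n$, with $\|\sum c_Ix_I\|^2=\sum|c_I|^2$ and with the symmetric group $\mathfrak S_n$ acting by $x_I\mapsto x_{\sigma I}$, and let $$A^0_{n,k}=\Bigl\{\sum c_Ix_I\in A_{n,k} \;:\; \sum_{j\notin J}c_{J\cup\{j\}}=0\ \text{ for every } J \text{ with } |J|=k-1\Bigr\},$$ an $\mathfrak S_n$-invariant subspace. For a tableau $v$ of shape $\mu$ and $0\le l\le n$ let $v_l$ be the Young diagram formed by the cells of $v$ that contain $1,\dots,l$. The Gelfand–Tsetlin subspace of $A^0_{n,k}$ corresponding to $v$ consists of the vectors that, for every $l\le n$, lie in the isotypic component of type $\pi_{v_l}$ with respect to the subgroup $\mathfrak S_l\subset\mathfrak S_n$ permuting $1,\dots,l$.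 Here $\pi_\lambda$ is the irreducible complex representation of $\mathfrak S_l$ corresponding to the diagram $\lambda$ (the Specht module, so that $\pi_{(l)}$ is trivial). A Gelfand–Tsetlin basis of $A^0_{n,k}$ is a basis $\{h^0_v\}$ indexed by the tableaux $v$ of shape $\mu$ such that each $h^0_v$ lies in the Gelfand–Tsetlin subspace corresponding to $v$. Put $$F_u=\sum_{i_1,\dots,i_k}(x_{i_1}-x_{p_1})\cdots(x_{i_k}-x_{p_k}),$$ where the sum runs over all indices $i_1,\dots,i_k\in\{1,\dots,n\}$ such that $i_j<p_j$ for all $j=1,\dots,k$ and $i_1,\dots,i_k,p_1,\dots,p_k$ are pairwise distinct. Then $F_u\neq0$, and the Gelfand–Tsetlin subspace of $A^0_{n,k}$ corresponding to $u$ is the line $\mathbb C F_u$. Moreover, $A^0_{n,k}$ has a Gelfand–Tsetlin basis consisting of unit vectors, and for every Gelfand–Tsetlin basis $\{h^0_v\}$ of $A^0_{n,k}$, $$h^0_u=c^0_u\,F_u$$ with a constant $c^0_u\in\mathbb C\setminus\{0\}$; if $\|h^0_u\|=1$, then $|c^0_u|=1/\|F_u\|$. -/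

import Mathlib

/-! Throughout, the letters `1, …, n` are the elements of `Fin n`, in their usual order, and the
variables `x_1, …, x_n` are the generators of `MvPolynomial (Fin n) ℂ`. -/

noncomputable section

namespace TwoRow

open MvPolynomial

/-! ### Young tableaux -/

/-- A (standard) Young tableau of shape `μ` with entries `Fin n`: a bijection between the letters
and the cells of `μ` whose entries increase along the rows and down the columns.
The cell `(i, j)` lies in row `i` and column `j`, both counted from `0`. -/
structure Tableau (n : ℕ) (μ : YoungDiagram) where
  /-- the cell that contains a given letter -/
  cell : Fin n ≃ μ.cells
  row_increasing : ∀ a b : Fin n,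
    (cell a).1.1 = (cell b).1.1 → (cell a).1.2 < (cell b).1.2 → a < b
  col_increasing : ∀ a b : Fin n,
    (cell a).1.2 = (cell b).1.2 → (cell a).1.1 < (cell b).1.1 → a < b

namespace Tableau

variable {n : ℕ} {μ : YoungDiagram}

theorem le_of_cell_le (u : Tableau n μ) {a b : Fin n} (h : (u.cell a).1 ≤ (u.cell b).1) :
    a ≤ b := by
  obtain ⟨h1, h2⟩ := Prod.le_def.1 h
  have hc : ((u.cell a).1.1, (u.cell b).1.2) ∈ μ.cells :=
    μ.isLowerSet (Prod.mk_le_mk.2 ⟨h1, le_rfl⟩) (u.cell b).2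
  obtain ⟨c, hc'⟩ := u.cell.surjective ⟨_, hc⟩
  have hc1 : (u.cell c).1.1 = (u.cell a).1.1 := by rw [hc']
  have hc2 : (u.cell c).1.2 = (u.cell b).1.2 := by rw [hc']
  have hac : a ≤ c := by
    rcases h2.lt_or_eq with h | h
    · exact (u.row_increasing a c hc1.symm (by omega)).le
    · exact (u.cell.injective (Subtype.ext (Prod.ext hc1.symm (by omega)))).le
  have hcb : c ≤ b := by
    rcases h1.lt_or_eq with h | h
    · exact (u.col_increasing c b hc2 (by omega)).le
    · exact (u.cell.injective (Subtype.ext (Prod.ext (by omega) hc2))).le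
  exact hac.trans hcb

/-- The set of letters in the `i`-th row of a tableau (rows are counted from `0`). -/
def row (u : Tableau n μ) (i : ℕ) : Set (Fin n) := {a | (u.cell a).1.1 = i}

/-- The diagram formed by the cells of the first `l` letters. The tableau `u`, as a path in the
Young graph, is the sequence `u.shape 0 = ∅, u.shape 1, …, u.shape n = μ`. -/
def shape (u : Tableau n μ) (l : ℕ) : YoungDiagram where
  cells := (Finset.univ.filter fun a : Fin n => (a : ℕ) < l).image fun a => (u.cell a).1
  isLowerSet := by
    intro c d hdc hc
    simp only [Finset.coe_image, Finset.coe_filter, Finset.mem_univ, true_and, Set.mem_image,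
      Set.mem_ofPred_eq] at hc ⊢
    obtain ⟨a, ha, rfl⟩ := hc
    obtain ⟨b, hb⟩ := u.cell.surjective ⟨d, μ.isLowerSet hdc (u.cell a).2⟩
    have hb' : (u.cell b).1 = d := by rw [hb]
    exact ⟨b, lt_of_le_of_lt (u.le_of_cell_le (hb'.trans_le hdc)) ha, hb'⟩

end Tableau

/-! ### Irreducible representations of the symmetric groups -/

/-- The action of the symmetric group on polynomials by substitution of indices,
`x_i ↦ x_{σ i}`. -/
def permRep (n : ℕ) :
    Representation ℂ (Equiv.Perm (Fin n)) (MvPolynomial (Fin n) ℂ) where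
  toFun σ := (rename σ).toLinearMap
  map_one' := by
    refine LinearMap.ext fun f => ?_
    simp
  map_mul' σ τ := by
    refine LinearMap.ext fun f => ?_
    simp [Equiv.Perm.coe_mul, rename_rename, Module.End.mul_apply]

/-- The Specht polynomial of a numbering `t` of the cells of `μ`: the product, over all pairs of
cells `c`, `d` in a common column with `c` above `d`, of the differences `x_{t c} - x_{t d}`. -/
def spechtPolynomial {n : ℕ} {μ : YoungDiagram} (t : μ.cells ≃ Fin n) : MvPolynomial (Fin n) ℂ :=
  ∏ c : μ.cells, ∏ d : μ.cells with c.1.2 = d.1.2 ∧ c.1.1 < d.1.1, (X (t c) - X (t d))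

/-- The Specht module of a diagram `μ` with `n` cells, in Specht's realization: the span of the
Specht polynomials of all numberings of the cells of `μ`. It carries the irreducible
representation `π_μ` of the symmetric group. -/
def specht (n : ℕ) (μ : YoungDiagram) : Subrepresentation (permRep n) where
  toSubmodule := Submodule.span ℂ (Set.range (spechtPolynomial (n := n) (μ := μ)))
  apply_mem_toSubmodule σ v hv := by
    induction hv using Submodule.span_induction with
    | mem x hx =>
      obtain ⟨t, rfl⟩ := hx
      refine Submodule.subset_span ⟨t.trans σ, ?_⟩
      simp [permRep, spechtPolynomial, map_prod]
    | zero => simp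
    | add x y _ _ hx hy => rw [map_add]; exact Submodule.add_mem _ hx hy
    | smul a x _ hx => rw [map_smul]; exact Submodule.smul_mem _ a hx

/-! ### The Gelfand–Tsetlin basis -/

/-- The isotypic component of type `σ` of the representation `ρ`, for `σ` irreducible:
the sum of the images of all intertwining maps from `σ` to `ρ`. -/
def isotypic {G V W : Type*} [Group G] [AddCommGroup V] [Module ℂ V] [AddCommGroup W]
    [Module ℂ W] (ρ : Representation ℂ G V) (σ : Representation ℂ G W) : Submodule ℂ V :=
  ⨆ f : Representation.IntertwiningMap σ ρ, LinearMap.range f.toLinearMap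

/-- The restriction of a representation of the symmetric group on `n` letters to the symmetric
group on the first `l` letters. -/
def restrict {n : ℕ} {V : Type*} [AddCommGroup V] [Module ℂ V]
    (ρ : Representation ℂ (Equiv.Perm (Fin n)) V) {l : ℕ} (hl : l ≤ n) :
    Representation ℂ (Equiv.Perm (Fin l)) V :=
  MonoidHom.comp ρ (Equiv.Perm.viaEmbeddingHom (Fin.castLEEmb hl))

/-- The Gelfand–Tsetlin subspace of a representation of the symmetric group on `n` letters that
corresponds to the tableau `u`: the vectors which, for every `l ≤ n`, lie in the isotypic
component of type `π_{u.shape l}` with respect to the symmetric group on the first `l` letters. -/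
def gtSubspace {n : ℕ} {V : Type*} [AddCommGroup V] [Module ℂ V]
    (ρ : Representation ℂ (Equiv.Perm (Fin n)) V) {μ : YoungDiagram} (u : Tableau n μ) :
    Submodule ℂ V :=
  ⨅ (l : ℕ) (hl : l ≤ n), isotypic (restrict ρ hl) (specht l (u.shape l)).toRepresentation

/-- A basis indexed by the tableaux of shape `μ` is a Gelfand–Tsetlin basis if its elements lie
in the corresponding Gelfand–Tsetlin subspaces. -/
def IsGelfandTsetlinBasis {n : ℕ} {V : Type*} [AddCommGroup V] [Module ℂ V]
    (ρ : Representation ℂ (Equiv.Perm (Fin n)) V) {μ : YoungDiagram}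
    (h : Module.Basis (Tableau n μ) ℂ V) : Prop :=
  ∀ u : Tableau n μ, h u ∈ gtSubspace ρ u

/-! ### The tensor model -/

/-- The exponent of the square-free monomial `x_I = ∏_{i ∈ I} x_i`. -/
def sqfreeExp {n : ℕ} (I : Finset (Fin n)) : Fin n →₀ ℕ := ∑ i ∈ I, Finsupp.single i 1

/-- The coefficient `c_I` of the square-free monomial `x_I` in a form. -/
def coeffAt {n : ℕ} (I : Finset (Fin n)) (f : MvPolynomial (Fin n) ℂ) : ℂ := f.coeff (sqfreeExp I)

/-- The space `A_{n,k}` of square-free homogeneous forms of degree `k` in `n` variables. -/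
def formSpace (n k : ℕ) : Submodule ℂ (MvPolynomial (Fin n) ℂ) :=
  Submodule.span ℂ {f | ∃ I : Finset (Fin n), I.card = k ∧ f = ∏ i ∈ I, X i}

/-- The standard norm squared `∑_I |c_I|²` of a form of degree `k`. -/
def formNormSq {n : ℕ} (k : ℕ) (f : MvPolynomial (Fin n) ℂ) : ℝ :=
  ∑ I ∈ Finset.powersetCard k (Finset.univ : Finset (Fin n)), ‖coeffAt I f‖ ^ 2

theorem permRep_mem_formSpace {n k : ℕ} (σ : Equiv.Perm (Fin n)) {f : MvPolynomial (Fin n) ℂ}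
    (hf : f ∈ formSpace n k) : permRep n σ f ∈ formSpace n k := by
  induction hf using Submodule.span_induction with
  | mem x hx =>
    obtain ⟨I, hI, rfl⟩ := hx
    refine Submodule.subset_span ⟨I.map σ.toEmbedding, by simpa using hI, ?_⟩
    simp [permRep, map_prod]
  | zero => simp
  | add x y _ _ hx hy => rw [map_add]; exact Submodule.add_mem _ hx hy
  | smul a x _ hx => rw [map_smul]; exact Submodule.smul_mem _ a hx

theorem coeffAt_permRep {n : ℕ} (σ : Equiv.Perm (Fin n)) (I : Finset (Fin n))
    (f : MvPolynomial (Fin n) ℂ) :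
    coeffAt (I.map σ.toEmbedding) (permRep n σ f) = coeffAt I f := by
  have h : sqfreeExp (I.map σ.toEmbedding) = (sqfreeExp I).mapDomain σ := by
    simp [sqfreeExp, Finsupp.mapDomain_finsetSum, Finsupp.mapDomain_single]
  rw [coeffAt, coeffAt, h]
  exact coeff_rename_mapDomain σ σ.injective f _

/-- The representation of the symmetric group in the subspace `A⁰_{n,k}` of the forms
`∑_I c_I x_I` in `A_{n,k}` such that `∑_{j ∉ J} c_{J ∪ {j}} = 0` for all `J` with `k - 1`
elements. -/
def tensorModel (n k : ℕ) : Subrepresentation (permRep n) where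
  toSubmodule :=
    { carrier := {f | f ∈ formSpace n k ∧ ∀ J : Finset (Fin n), J.card + 1 = k →
        ∑ j ∈ Jᶜ, coeffAt (insert j J) f = 0}
      add_mem' := by
        rintro f g ⟨hf, hf'⟩ ⟨hg, hg'⟩
        refine ⟨Submodule.add_mem _ hf hg, fun J hJ => ?_⟩
        have h1 := hf' J hJ
        have h2 := hg' J hJ
        simp only [coeffAt] at h1 h2 ⊢
        simp [Finset.sum_add_distrib, h1, h2]
      zero_mem' := ⟨Submodule.zero_mem _, fun J _ => by simp [coeffAt]⟩
      smul_mem' := by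
        rintro c f ⟨hf, hf'⟩
        refine ⟨Submodule.smul_mem _ c hf, fun J hJ => ?_⟩
        have h1 := hf' J hJ
        simp only [coeffAt] at h1 ⊢
        simp [← Finset.mul_sum, h1] }
  apply_mem_toSubmodule σ f hf := by
    refine ⟨permRep_mem_formSpace σ hf.1, fun J hJ => ?_⟩
    have h1 := hf.2 (J.map σ.symm.toEmbedding) (by simpa using hJ)
    rw [← h1]
    symm
    refine Finset.sum_equiv σ (by intro i; simp [Finset.mem_map_equiv]) ?_
    intro i _
    rw [← coeffAt_permRep σ]
    congr 1
    ext a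
    simp [Finset.mem_map_equiv]

/-- The sum of the products `(x_{i_1} - x_{p_1}) ⋯ (x_{i_k} - x_{p_k})` over all indices
`i_1, …, i_k` with `i_j < p_j` for all `j` and `i_1, …, i_k, p_1, …, p_k` pairwise distinct. -/
def gtForm {n k : ℕ} (p : Fin k → Fin n) : MvPolynomial (Fin n) ℂ :=
  open Classical in
  ∑ i : Fin k → Fin n with (∀ j, i j < p j) ∧ Function.Injective (Sum.elim i p),
    ∏ j : Fin k, (X (i j) - X (p j))

end TwoRow

end

/-!
Let `μ` have at most two rows, with `k` cells in the second one.

The span of the Specht polynomials of a diagram with rows `l - m` and `m` is the span of the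
products of `m` differences `x_a - x_b` in disjoint pairs of letters (`specht_eq_pairSpan`), and
lies in `A⁰_{l,m}`. There the sum of all transpositions of `l` letters acts by a scalar
(`sum_swap_apply`), which determines `m` as long as `2m ≤ l` (`swapEigenvalue_injOn`). Hence these
sums, for `l = 0, …, n`, act by scalars in the Gelfand–Tsetlin subspace of each tableau, and the
scalars tell the tableaux apart, because a tableau with two rows is determined by the number of
letters of its second row among the first `l`, for all `l` (`Tableau.eq_of_rowLen_shape_eq`).

It remains to find, in each of these subspaces, a nonzero vector, and to see that there are enough
of them. Modulo the squares of the variables `(x_a - x_b) (x_a + x_b) = 0`; therefore, if the sum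
that defines `F_u` is carried out over `i_k` first, then over `i_{k-1}`, and so on, then `F_u`
becomes a product of linear forms: `p_j` contributes `∑_{i < p_j} x_i - r_j x_{p_j}`, where
`r_j = p_j - 1 - 2(j - 1)` is the number of choices for `i_j` once `i_1, …, i_{j-1}` are fixed
(`gtForm_snoc`). For given
`l`, the factors with `p_j > l` are invariant under the permutations of the first `l` letters, and
multiplication by them maps the Specht module of the diagram of the first `l` letters into
`A⁰_{n,k}`; the product of the other factors lies in that Specht module
(`exists_operator_gtForm`). So `F_u` lies in the Gelfand–Tsetlin subspace of `u`
(`gtForm_mem_gtSubspace`). It does not vanish at the indicator of the second row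
(`gtForm_ne_zero`).

Being joint eigenvectors with distinct eigenvalues, the `F_u` are linearly independent. They span
`A⁰_{n,k}`, because an element of this space is determined by its coefficients at the second rows of
the tableaux (`coeff_eq_zero_of_isBallot`, `Tableau.exists_of_ballot`), which bounds the dimension
by the number of tableaux. In the basis of the `F_u` the joint eigenspaces are the lines spanned by
the basis vectors (`mem_gtSubspace_iff`).
-/

noncomputable section

namespace TwoRow

/-! ### Coefficients at ballot sets -/

/-- A set `P` of natural numbers is a ballot set up to `n` if at most half of the first `l` numbers
lie in `P`, for all `l ≤ n`. For `P ⊆ {0, …, n-1}` this says that `P` is the second row of a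
standard tableau. -/
def IsBallot (n : ℕ) (P : Finset ℕ) : Prop := ∀ l ≤ n, 2 * (P.filter (· < l)).card ≤ l

open Polynomial in
/-- There are no nonzero square-free forms of degree `k > n/2` in `n` variables that are annihilated
by `∑ ∂/∂x_i`. Such a form is invariant under translations along `(1, …, 1)`, so that its value at
the indicator of `I`, which is `c_I`, equals its value at minus the indicator of the complement
of `I`, which vanishes because the complement has fewer than `k` elements. -/
theorem coeff_eq_zero_of_lt_two_mul {n k : ℕ} (hk : n < 2 * k) (c : Finset ℕ → ℂ)
    (hc : ∀ J ⊆ Finset.range n, J.card + 1 = k → ∑ j ∈ Finset.range n \ J, c (insert j J) = 0)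
    {I : Finset ℕ} (hI : I ⊆ Finset.range n) (hIk : I.card = k) : c I = 0 := by
  classical
  -- `g t` is the value of the form at the indicator of `I` minus `t • (1, …, 1)`
  let e : ℕ → ℂ[X] := fun i => C (if i ∈ I then 1 else 0) - X
  let g : ℂ[X] := ∑ K ∈ (Finset.range n).powersetCard k, C (c K) * ∏ i ∈ K, e i
  obtain ⟨k, rfl⟩ : ∃ k', k = k' + 1 := ⟨k - 1, by omega⟩
  have hder : derivative g = 0 := by
    have he : ∀ i, derivative (e i) = -1 := fun i => by
      simp only [e, derivative_sub, derivative_C, derivative_X, zero_sub]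
    have h1 : derivative g = -∑ K ∈ (Finset.range n).powersetCard (k + 1), ∑ i ∈ K,
        C (c K) * ∏ b ∈ K.erase i, e b := by
      simp only [g, derivative_sum, derivative_C_mul, derivative_prod_finset, he,
        ← Finset.sum_neg_distrib, Finset.mul_sum, mul_neg, mul_one]
    have h2 : ∑ K ∈ (Finset.range n).powersetCard (k + 1), ∑ i ∈ K,
        C (c K) * ∏ b ∈ K.erase i, e b =
        ∑ J ∈ (Finset.range n).powersetCard k, ∑ j ∈ Finset.range n \ J,
          C (c (insert j J)) * ∏ b ∈ J, e b := by
      rw [Finset.sum_sigma', Finset.sum_sigma']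
      refine Finset.sum_bij' (fun x _ => ⟨x.1.erase x.2, x.2⟩) (fun x _ => ⟨insert x.2 x.1, x.2⟩)
        ?_ ?_ ?_ ?_ ?_
      · rintro ⟨K, i⟩ h
        simp only [Finset.mem_sigma, Finset.mem_powersetCard, Finset.mem_sdiff] at h ⊢
        exact ⟨⟨(Finset.erase_subset _ _).trans h.1.1, by
          rw [Finset.card_erase_of_mem h.2, h.1.2]; rfl⟩, h.1.1 h.2, by simp⟩
      · rintro ⟨J, j⟩ h
        simp only [Finset.mem_sigma, Finset.mem_powersetCard, Finset.mem_sdiff] at h ⊢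
        exact ⟨⟨Finset.insert_subset h.2.1 h.1.1, by
          rw [Finset.card_insert_of_notMem h.2.2, h.1.2]⟩, by simp⟩
      · rintro ⟨K, i⟩ h
        simp only [Finset.mem_sigma] at h
        simp [Finset.insert_erase h.2]
      · rintro ⟨J, j⟩ h
        simp only [Finset.mem_sigma, Finset.mem_sdiff] at h
        simp [Finset.erase_insert h.2.2]
      · rintro ⟨K, i⟩ h
        simp only [Finset.mem_sigma] at h
        simp [Finset.insert_erase h.2]
    rw [h1, h2, Finset.sum_eq_zero, neg_zero]
    intro J hJ
    rw [Finset.mem_powersetCard] at hJ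
    rw [← Finset.sum_mul, ← map_sum, hc J hJ.1 (by rw [hJ.2]), map_zero, zero_mul]
  have h0 : g.eval 0 = c I := by
    simp only [g, eval_finsetSum, eval_mul, eval_C, eval_prod]
    rw [Finset.sum_eq_single I]
    · rw [Finset.prod_eq_one (fun i hi => by simp [e, hi]), mul_one]
    · intro K hK hne
      rw [Finset.mem_powersetCard] at hK
      obtain ⟨i, hi, hi'⟩ : ∃ i ∈ K, i ∉ I := by
        by_contra! h
        exact hne (Finset.eq_of_subset_of_card_le h (by rw [hIk, hK.2]))
      rw [Finset.prod_eq_zero hi (by simp [e, hi']), mul_zero]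
    · intro h
      exact absurd (Finset.mem_powersetCard.2 ⟨hI, hIk⟩) h
  have h1 : g.eval 1 = 0 := by
    simp only [g, eval_finsetSum, eval_mul, eval_C, eval_prod]
    refine Finset.sum_eq_zero fun K hK => ?_
    rw [Finset.mem_powersetCard] at hK
    obtain ⟨i, hi, hi'⟩ : ∃ i ∈ K, i ∈ I := by
      by_contra! h
      have := Finset.card_le_card (Finset.union_subset hK.1 hI)
      rw [Finset.card_union_of_disjoint (Finset.disjoint_left.2 h), Finset.card_range] at this
      omega
    rw [Finset.prod_eq_zero hi (by simp [e, hi']), mul_zero]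
  rw [← h0, eq_C_of_derivative_eq_zero hder, eval_C, ← h1,
    eq_C_of_derivative_eq_zero hder, eval_C]
  simp

/-- An element of `A⁰_{n,k}` is determined by its coefficients at the ballot sets. The induction
splits a form `f = g + x_n h`, with `h ∈ A⁰_{n-1,k-1}`, and `g ∈ A⁰_{n-1,k}` if `h = 0`. -/
theorem coeff_eq_zero_of_isBallot : ∀ {n k : ℕ} (c : Finset ℕ → ℂ)
    (_ : ∀ J ⊆ Finset.range n, J.card + 1 = k → ∑ j ∈ Finset.range n \ J, c (insert j J) = 0)
    (_ : ∀ P ⊆ Finset.range n, P.card = k → IsBallot n P → c P = 0)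
    {I : Finset ℕ} (_ : I ⊆ Finset.range n) (_ : I.card = k), c I = 0 := by
  intro n
  induction n with
  | zero =>
    intro k c _ hb I hI hIk
    refine hb I hI hIk fun l hl => ?_
    obtain rfl : I = ∅ := by simpa using hI
    simp
  | succ n ih =>
    intro k c hc hb I hI hIk
    rcases lt_or_ge (n + 1) (2 * k) with hk | hk
    · exact coeff_eq_zero_of_lt_two_mul hk c hc hI hIk
    have hballot : ∀ P ⊆ Finset.range (n + 1), P.card = k → IsBallot n P →
        IsBallot (n + 1) P := by
      intro P _ hPk h l hl
      rcases hl.lt_or_eq with hl | rfl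
      · exact h l (by omega)
      · exact (Nat.mul_le_mul_left 2 ((Finset.card_filter_le _ _).trans hPk.le)).trans hk
    have hsub : Finset.range n ⊆ Finset.range (n + 1) := Finset.range_subset_range.2 n.le_succ
    have hn : ∀ J ⊆ Finset.range n, n ∉ J := fun J hJ h => by simpa using hJ h
    have hlast : ∀ J ⊆ Finset.range n, J.card + 1 = k → c (insert n J) = 0 := by
      intro J hJ hJk
      refine ih (fun J => c (insert n J)) (k := J.card) ?_ ?_ hJ rfl
      · intro K hK hKk
        have h := hc (insert n K) (Finset.insert_subset (by simp) (hK.trans hsub))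
          (by rw [Finset.card_insert_of_notMem (hn K hK)]; omega)
        rw [← h]
        refine Finset.sum_congr ?_ fun j _ => by rw [Finset.insert_comm]
        ext x
        simp only [Finset.mem_sdiff, Finset.mem_range, Finset.mem_insert]
        constructor
        · rintro ⟨h1, h2⟩
          exact ⟨by omega, by rintro (h | h); exacts [by omega, h2 h]⟩
        · rintro ⟨h1, h2⟩
          push Not at h2
          exact ⟨by omega, h2.2⟩
      · intro P hP hPk hPb
        have hcard : (insert n P).card = k := by
          rw [Finset.card_insert_of_notMem (hn P hP)]; omega
        have hss : insert n P ⊆ Finset.range (n + 1) :=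
          Finset.insert_subset (by simp) (hP.trans hsub)
        refine hb _ hss hcard (hballot _ hss hcard fun l hl => ?_)
        rw [Finset.filter_insert, if_neg (by omega)]
        exact hPb l hl
    by_cases hnI : n ∈ I
    · rw [← Finset.insert_erase hnI]
      refine hlast _ ?_ (by rw [Finset.card_erase_add_one hnI, hIk])
      intro x hx
      rw [Finset.mem_erase] at hx
      have := hI hx.2
      rw [Finset.mem_range] at this ⊢
      omega
    · refine ih c (k := k) ?_ (fun P hP hPk hPb => hb P (hP.trans hsub) hPk
        (hballot P (hP.trans hsub) hPk hPb)) ?_ hIk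
      · intro J hJ hJk
        rw [← hc J (hJ.trans hsub) hJk, Finset.range_add_one,
          Finset.insert_sdiff_of_notMem _ (hn J hJ), Finset.sum_insert (by simp),
          hlast J hJ hJk, zero_add]
      · intro x hx
        have := hI hx
        rw [Finset.mem_range] at this ⊢
        have : x ≠ n := fun h => hnI (h ▸ hx)
        omega

open MvPolynomial

/-! ### Square-free forms and their coefficients -/

theorem sqfreeExp_apply {n : ℕ} (I : Finset (Fin n)) (a : Fin n) :
    sqfreeExp I a = if a ∈ I then 1 else 0 := by
  classical
  simp [sqfreeExp, Finsupp.finsetSum_apply, Finsupp.single_apply]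

theorem prod_X_eq_monomial {n : ℕ} (I : Finset (Fin n)) :
    (∏ i ∈ I, X i : MvPolynomial (Fin n) ℂ) = monomial (sqfreeExp I) 1 := by
  rw [sqfreeExp, monomial_sum_one]; rfl

theorem coeff_eq_zero_of_mem_formSpace {n k : ℕ} {f : MvPolynomial (Fin n) ℂ}
    (hf : f ∈ formSpace n k) {d : Fin n →₀ ℕ}
    (hd : ∀ I : Finset (Fin n), I.card = k → d ≠ sqfreeExp I) : f.coeff d = 0 := by
  induction hf using Submodule.span_induction with
  | mem x hx =>
    obtain ⟨I, hI, rfl⟩ := hx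
    rw [prod_X_eq_monomial, coeff_monomial, if_neg (hd I hI).symm]
  | zero => simp
  | add x y _ _ hx hy => rw [coeff_add, hx, hy, add_zero]
  | smul a x _ hx => rw [coeff_smul, hx, smul_zero]

theorem formSpace_ext {n k : ℕ} {f g : MvPolynomial (Fin n) ℂ} (hf : f ∈ formSpace n k)
    (hg : g ∈ formSpace n k)
    (h : ∀ I : Finset (Fin n), I.card = k → coeffAt I f = coeffAt I g) : f = g := by
  ext d
  by_cases hd : ∃ I : Finset (Fin n), I.card = k ∧ d = sqfreeExp I
  · obtain ⟨I, hI, rfl⟩ := hd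
    exact h I hI
  · push Not at hd
    rw [coeff_eq_zero_of_mem_formSpace hf hd, coeff_eq_zero_of_mem_formSpace hg hd]

theorem coeffAt_permRep_symm {n : ℕ} (σ : Equiv.Perm (Fin n)) (I : Finset (Fin n))
    (f : MvPolynomial (Fin n) ℂ) :
    coeffAt I (permRep n σ f) = coeffAt (I.map σ.symm.toEmbedding) f := by
  rw [← coeffAt_permRep σ (I.map σ.symm.toEmbedding)]
  congr 1
  ext a
  simp [Finset.mem_map_equiv]

theorem formNormSq_smul {n k : ℕ} (c : ℂ) (f : MvPolynomial (Fin n) ℂ) :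
    formNormSq k (c • f) = ‖c‖ ^ 2 * formNormSq k f := by
  simp [formNormSq, coeffAt, Finset.mul_sum, mul_pow]

theorem formNormSq_pos {n k : ℕ} {f : MvPolynomial (Fin n) ℂ} (hf : f ∈ formSpace n k)
    (h0 : f ≠ 0) : 0 < formNormSq k f := by
  have hnn : 0 ≤ formNormSq k f := Finset.sum_nonneg fun I _ => by positivity
  refine lt_of_le_of_ne hnn fun h => h0 ?_
  refine formSpace_ext hf (Submodule.zero_mem _) fun I hI => ?_
  have h1 := (Finset.sum_eq_zero_iff_of_nonneg (fun I _ => by positivity)).1 h.symm I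
    (by simpa [Finset.mem_powersetCard] using hI)
  have h2 : coeffAt I f = 0 := by simpa using h1
  rw [h2]; simp [coeffAt]

/-- The derivation `∑_i ∂/∂x_i`. -/
def totalDeriv (n : ℕ) : Derivation ℂ (MvPolynomial (Fin n) ℂ) (MvPolynomial (Fin n) ℂ) :=
  ∑ i, pderiv i

/-- On square-free forms the equations that define `A⁰_{n,k}` say that `∑_i ∂f/∂x_i = 0`. -/
theorem mem_tensorModel_of_totalDeriv {n k : ℕ} {f : MvPolynomial (Fin n) ℂ}
    (hf : f ∈ formSpace n k) (hD : totalDeriv n f = 0) :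
    f ∈ (tensorModel n k).toSubmodule := by
  refine ⟨hf, fun J hJ => ?_⟩
  have h := congrArg (coeff (sqfreeExp J)) hD
  have h1 : coeff (sqfreeExp J) (totalDeriv n f) = ∑ i, coeff (sqfreeExp J) (pderiv i f) := by
    rw [totalDeriv, ← coeff_sum]
    congr 1
    rw [← Derivation.coeFnAddMonoidHom_apply, map_sum, Finset.sum_apply]
    rfl
  rw [h1, coeff_zero, ← Finset.sum_add_sum_compl J] at h
  rw [Finset.sum_eq_zero, zero_add] at h
  · rw [← h]
    refine Finset.sum_congr rfl fun j hj => ?_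
    rw [Finset.mem_compl] at hj
    rw [coeff_pderiv, coeffAt, sqfreeExp_apply, if_neg hj]
    have : sqfreeExp (insert j J) = sqfreeExp J + Finsupp.single j 1 := by
      rw [sqfreeExp, Finset.sum_insert hj, add_comm]; rfl
    rw [this]; simp
  · intro j hj
    rw [coeff_pderiv, coeff_eq_zero_of_mem_formSpace hf, zero_mul]
    intro I _ hI
    have := DFunLike.congr_fun hI j
    rw [Finsupp.add_apply, sqfreeExp_apply, if_pos hj, sqfreeExp_apply] at this
    split_ifs at this <;> simp at this

/-! ### Products of differences -/

/-- The product `∏_j (x_{a_j} - x_{b_j})`. -/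
def pairProd {n k : ℕ} (a b : Fin k → Fin n) : MvPolynomial (Fin n) ℂ :=
  ∏ j : Fin k, (X (a j) - X (b j))

theorem pairProd_mem_formSpace {n k : ℕ} {a b : Fin k → Fin n}
    (h : Function.Injective (Sum.elim a b)) : pairProd a b ∈ formSpace n k := by
  classical
  have e : pairProd a b = ∏ j : Fin k, (X (a j) + (-1 : ℂ) • X (b j)) := by
    refine Finset.prod_congr rfl fun j _ => ?_
    rw [neg_smul, one_smul, sub_eq_add_neg]
  rw [e, Finset.prod_add]
  refine Submodule.sum_mem _ fun t _ => ?_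
  rw [Finset.prod_smul, mul_smul_comm]
  refine Submodule.smul_mem _ _ (Submodule.subset_span ?_)
  let c : Fin k → Fin n := fun j => if j ∈ t then a j else b j
  have hc : Function.Injective c := by
    intro i j hij
    simp only [c] at hij
    split_ifs at hij
    · exact Sum.inl_injective (h hij)
    · exact absurd (@h (Sum.inl i) (Sum.inr j) hij) (by simp)
    · exact absurd (@h (Sum.inr i) (Sum.inl j) hij) (by simp)
    · exact Sum.inr_injective (h hij)
  refine ⟨Finset.univ.image c, by rw [Finset.card_image_of_injective _ hc]; simp, ?_⟩
  rw [Finset.prod_image (fun _ _ _ _ e => hc e), ← Finset.prod_mul_prod_compl t]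
  congr 1
  · exact Finset.prod_congr rfl fun j hj => by simp [c, hj]
  · refine Finset.prod_congr (by ext; simp) fun j hj => ?_
    rw [Finset.mem_compl] at hj
    simp [c, hj]

theorem pairProd_mem_tensorModel {n k : ℕ} {a b : Fin k → Fin n}
    (h : Function.Injective (Sum.elim a b)) :
    pairProd a b ∈ (tensorModel n k).toSubmodule := by
  refine mem_tensorModel_of_totalDeriv (pairProd_mem_formSpace h) ?_
  have hX : ∀ i : Fin n, totalDeriv n (X i) = 1 := by
    intro i
    rw [totalDeriv, ← Derivation.coeFnAddMonoidHom_apply, map_sum, Finset.sum_apply]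
    simp only [Derivation.coeFnAddMonoidHom_apply]
    rw [Finset.sum_eq_single i]
    · exact pderiv_X_self i
    · intro j _ hj
      rw [pderiv_X, Pi.single_eq_of_ne (Ne.symm hj)]
    · simp
  refine Finset.prod_induction (fun j => (X (a j) - X (b j) : MvPolynomial (Fin n) ℂ))
    (fun f => totalDeriv n f = 0) ?_ ?_ ?_
  · intro f g hf hg
    rw [Derivation.leibniz, hf, hg]; simp
  · exact Derivation.map_one_eq_zero _
  · intro j _
    rw [map_sub, hX, hX, sub_self]

theorem rename_pairProd {l n k : ℕ} (g : Fin l → Fin n) (a b : Fin k → Fin l) :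
    rename g (pairProd a b) = pairProd (g ∘ a) (g ∘ b) := by
  simp [pairProd, map_prod]

/-! ### The sum of all transpositions -/

/-- The scalar by which the sum `∑_{i,j} (i j)` over all ordered pairs of letters acts in
`A⁰_{l,m}`. The `l` pairs with `i = j` are included. -/
def swapEigenvalue (l m : ℕ) : ℂ := (m : ℂ) ^ 2 + ((l : ℂ) - m) ^ 2 - 2 * m

/-- A transposition fixes `x_I` if both letters or neither lie in `I`, which accounts for
`m² + (l - m)²` of the ordered pairs. The remaining terms contribute `-2m` times the coefficient
of `x_I` by the equations that define `A⁰_{l,m}`. -/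
theorem sum_swap_apply {l m : ℕ} {f : MvPolynomial (Fin l) ℂ}
    (hf : f ∈ (tensorModel l m).toSubmodule) :
    ∑ i, ∑ j, permRep l (Equiv.swap i j) f = swapEigenvalue l m • f := by
  classical
  refine formSpace_ext (Submodule.sum_mem _ fun i _ => Submodule.sum_mem _ fun j _ =>
    permRep_mem_formSpace _ hf.1) (Submodule.smul_mem _ _ hf.1) fun I hI => ?_
  have e1 : coeffAt I (∑ i, ∑ j, permRep l (Equiv.swap i j) f)
      = ∑ i, ∑ j, coeffAt (I.map (Equiv.swap i j).toEmbedding) f := by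
    have : coeffAt I (∑ i, ∑ j, permRep l (Equiv.swap i j) f)
      = ∑ i, ∑ j, coeffAt I (permRep l (Equiv.swap i j) f) := by
        simp only [coeffAt, coeff_sum]
    rw [this]
    simp only [coeffAt_permRep_symm, Equiv.symm_swap]
  have same : ∀ i j, (i ∈ I ↔ j ∈ I) → I.map (Equiv.swap i j).toEmbedding = I := by
    intro i j hij
    ext a
    rw [Finset.mem_map_equiv, Equiv.symm_swap]
    rcases eq_or_ne a i with rfl | hi
    · rw [Equiv.swap_apply_left, hij]
    rcases eq_or_ne a j with rfl | hj
    · rw [Equiv.swap_apply_right, hij]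
    · rw [Equiv.swap_apply_of_ne_of_ne hi hj]
  have diff : ∀ i j, i ∈ I → j ∉ I →
      I.map (Equiv.swap i j).toEmbedding = insert j (I.erase i) := by
    intro i j hi hj
    have hne : i ≠ j := fun h => hj (h ▸ hi)
    ext a
    rw [Finset.mem_map_equiv, Equiv.symm_swap]
    rcases eq_or_ne a i with rfl | hi'
    · simp [hj, hne]
    rcases eq_or_ne a j with rfl | hj'
    · simp [hi]
    · rw [Equiv.swap_apply_of_ne_of_ne hi' hj']; simp [hi', hj']
  -- The defining equation of `A⁰` at `J = I \ {i}`, with the term `j = i` moved to the right.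
  have key : ∀ i ∈ I, ∑ j ∈ Iᶜ, coeffAt (insert j (I.erase i)) f = - coeffAt I f := by
    intro i hi
    have h := hf.2 (I.erase i) (by rw [Finset.card_erase_add_one hi, hI])
    rw [Finset.compl_erase, Finset.sum_insert (by simpa using hi), Finset.insert_erase hi] at h
    linear_combination h
  have hin : ∀ i ∈ I, ∑ j, coeffAt (I.map (Equiv.swap i j).toEmbedding) f
      = (m - 1) * coeffAt I f := by
    intro i hi
    rw [← Finset.sum_add_sum_compl I,
      Finset.sum_congr rfl (fun j hj => by rw [same i j (by simp [hi, hj])]),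
      Finset.sum_congr (s₁ := Iᶜ) rfl (fun j hj => by rw [diff i j hi (by simpa using hj)]),
      key i hi, Finset.sum_const, hI, nsmul_eq_mul]
    ring
  have hle : m ≤ l := by simpa [hI] using Finset.card_le_univ I
  have hc : ((Iᶜ.card : ℕ) : ℂ) = l - m := by
    rw [Finset.card_compl, hI, Fintype.card_fin, Nat.cast_sub hle]
  have hout : ∑ i ∈ Iᶜ, ∑ j, coeffAt (I.map (Equiv.swap i j).toEmbedding) f
      = (((l : ℂ) - m) ^ 2 - m) * coeffAt I f := by
    have : ∀ i ∈ Iᶜ, ∑ j, coeffAt (I.map (Equiv.swap i j).toEmbedding) f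
        = (l - m) * coeffAt I f + ∑ j ∈ I, coeffAt (insert i (I.erase j)) f := by
      intro i hi
      rw [← Finset.sum_compl_add_sum I]
      rw [Finset.mem_compl] at hi
      congr 1
      · rw [Finset.sum_congr rfl (fun j hj => by
          rw [same i j (by rw [Finset.mem_compl] at hj; simp [hi, hj])]), Finset.sum_const,
          nsmul_eq_mul, hc]
      · exact Finset.sum_congr rfl fun j hj => by rw [Equiv.swap_comm, diff j i hj hi]
    rw [Finset.sum_congr rfl this, Finset.sum_add_distrib, Finset.sum_comm,
      Finset.sum_congr (s₁ := I) rfl key, Finset.sum_const, Finset.sum_const, hI, nsmul_eq_mul,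
      nsmul_eq_mul, hc]
    ring
  rw [e1, ← Finset.sum_add_sum_compl I, Finset.sum_congr rfl hin, hout, Finset.sum_const, hI,
    coeffAt, coeffAt, coeff_smul, swapEigenvalue, nsmul_eq_mul, smul_eq_mul]
  ring

/-- The bounds are needed: the eigenvalue is symmetric in `m` about `(l + 1) / 2`. -/
theorem swapEigenvalue_injOn {l m m' : ℕ} (hm : 2 * m ≤ l) (hm' : 2 * m' ≤ l)
    (h : swapEigenvalue l m = swapEigenvalue l m') : m = m' := by
  have h1 : ((m : ℤ) - m') * (m + m' - l - 1) = 0 := by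
    have : ((m : ℂ) - m') * (m + m' - l - 1) = 0 := by
      simp only [swapEigenvalue] at h
      linear_combination h / 2
    exact_mod_cast this
  rcases mul_eq_zero.1 h1 with h2 | h2 <;> omega

/-! ### Adjoining one pair of letters -/

/-- Multiplication by `x_i` followed by removal of the terms divisible by `x_i²`, written as
`f ↦ x_i · f|_{x_i = 0}`. On square-free forms this is the multiplication by `x_i` in
`ℂ[x_1, …, x_n]/(x_1², …, x_n²)`. -/
def sqfreeMul {n : ℕ} (i : Fin n) :
    MvPolynomial (Fin n) ℂ →ₗ[ℂ] MvPolynomial (Fin n) ℂ :=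
  LinearMap.mulLeft ℂ (X i) ∘ₗ
    (aeval fun j => if j = i then (0 : MvPolynomial (Fin n) ℂ) else X j).toLinearMap

theorem permRep_sqfreeMul {n : ℕ} (σ : Equiv.Perm (Fin n)) (i : Fin n)
    (f : MvPolynomial (Fin n) ℂ) :
    permRep n σ (sqfreeMul i f) = sqfreeMul (σ i) (permRep n σ f) := by
  have h : ((rename σ).comp
        (aeval fun j => if j = i then (0 : MvPolynomial (Fin n) ℂ) else X j)) =
      (aeval fun j => if j = σ i then (0 : MvPolynomial (Fin n) ℂ) else X j).comp (rename σ) := by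
    refine algHom_ext fun j => ?_
    by_cases hj : j = i <;> simp [hj]
  have h' := DFunLike.congr_fun h f
  simp only [AlgHom.comp_apply] at h'
  change rename σ (X i * aeval _ f) = X (σ i) * aeval _ (rename σ f)
  rw [map_mul, rename_X, h']

theorem aeval_pairProd {n k : ℕ} (i : Fin n) (a b : Fin k → Fin n) :
    aeval (fun j => if j = i then (0 : MvPolynomial (Fin n) ℂ) else X j) (pairProd a b) =
      ∏ j : Fin k, ((if a j = i then 0 else X (a j)) - (if b j = i then 0 else X (b j))) := by
  simp [pairProd, map_prod]

theorem sqfreeMul_pairProd {n k : ℕ} {i : Fin n} {a b : Fin k → Fin n}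
    (hi : i ∉ Set.range (Sum.elim a b)) : sqfreeMul i (pairProd a b) = X i * pairProd a b := by
  rw [sqfreeMul, LinearMap.comp_apply, AlgHom.toLinearMap_apply, aeval_pairProd,
    LinearMap.mulLeft_apply, pairProd]
  congr 1
  refine Finset.prod_congr rfl fun j _ => ?_
  have ha : a j ≠ i := fun h => hi ⟨Sum.inl j, h⟩
  have hb : b j ≠ i := fun h => hi ⟨Sum.inr j, h⟩
  rw [if_neg ha, if_neg hb]

/-- Modulo squares, `(x_a - x_b) (x_a + x_b) = 0`. -/
theorem sqfreeMul_pairProd_add {n k : ℕ} {a b : Fin k → Fin n}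
    (h : Function.Injective (Sum.elim a b)) (j : Fin k) :
    sqfreeMul (a j) (pairProd a b) + sqfreeMul (b j) (pairProd a b) = 0 := by
  have hab : ∀ i, a i ≠ b j := fun i e => absurd (@h (Sum.inl i) (Sum.inr j) e) (by simp)
  have hba : ∀ i, b i ≠ a j := fun i e => absurd (@h (Sum.inr i) (Sum.inl j) e) (by simp)
  have haa : ∀ i, i ≠ j → a i ≠ a j := fun i hi e => hi (Sum.inl_injective (h e))
  have hbb : ∀ i, i ≠ j → b i ≠ b j := fun i hi e => hi (Sum.inr_injective (h e))
  simp only [sqfreeMul, LinearMap.comp_apply, AlgHom.toLinearMap_apply, aeval_pairProd,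
    LinearMap.mulLeft_apply, hab, hba, if_false]
  rw [← Finset.mul_prod_erase _ _ (Finset.mem_univ j),
    ← Finset.mul_prod_erase _ _ (Finset.mem_univ j), if_pos rfl, if_pos rfl,
    Finset.prod_congr rfl (g := fun i => (X (a i) - X (b i) : MvPolynomial (Fin n) ℂ)),
    Finset.prod_congr (s₁ := Finset.univ.erase j)
      (f := fun x => (X (a x) - if b x = b j then 0 else X (b x) : MvPolynomial (Fin n) ℂ)) rfl
      (g := fun i => (X (a i) - X (b i) : MvPolynomial (Fin n) ℂ))]
  · ring
  · intro i hi
    rw [if_neg (hbb i (Finset.ne_of_mem_erase hi))]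
  · intro i hi
    rw [if_neg (haa i (Finset.ne_of_mem_erase hi))]

/-- The operator `∑_{i < q} x_i - r x_q`, where the variables act by multiplication modulo
squares. -/
def adjoin {n : ℕ} (q : Fin n) (r : ℂ) :
    MvPolynomial (Fin n) ℂ →ₗ[ℂ] MvPolynomial (Fin n) ℂ :=
  ∑ i ∈ Finset.Iio q, sqfreeMul i - r • sqfreeMul q

theorem permRep_adjoin {n l : ℕ} {q : Fin n} (hq : l ≤ q) (r : ℂ) {σ : Equiv.Perm (Fin n)}
    (hσ : ∀ i : Fin n, l ≤ i → σ i = i) (f : MvPolynomial (Fin n) ℂ) :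
    permRep n σ (adjoin q r f) = adjoin q r (permRep n σ f) := by
  have hlt : ∀ i : Fin n, σ i < q ↔ i < q := by
    intro i
    by_cases hi : l ≤ i
    · rw [hσ i hi]
    · have h1 : ¬ l ≤ σ i := fun h => hi (by rw [← σ.injective (hσ _ h)]; exact h)
      rw [Fin.lt_def, Fin.lt_def]
      omega
  simp only [adjoin, LinearMap.sub_apply, LinearMap.smul_apply, LinearMap.sum_apply, map_sub,
    map_sum, map_smul, permRep_sqfreeMul, hσ q hq]
  congr 1
  exact Finset.sum_equiv σ (by simp [hlt]) (fun _ _ => rfl)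

theorem injective_sumElim_snoc {n k : ℕ} {a b : Fin k → Fin n} {x y : Fin n} :
    Function.Injective
        (Sum.elim (Fin.snoc a x : Fin (k + 1) → Fin n) (Fin.snoc b y : Fin (k + 1) → Fin n)) ↔
      Function.Injective (Sum.elim a b) ∧ x ∉ Set.range (Sum.elim a b) ∧
        y ∉ Set.range (Sum.elim a b) ∧ x ≠ y := by
  rw [Sum.elim_injective, Sum.elim_injective, Fin.snoc_injective_iff, Fin.snoc_injective_iff]
  simp only [Fin.forall_fin_succ', Fin.snoc_castSucc, Fin.snoc_last, Set.mem_range,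
    Sum.exists, Sum.elim_inl, Sum.elim_inr, not_or, not_exists, forall_and]
  constructor
  · rintro ⟨⟨ha, hx⟩, ⟨hb, hy⟩, ⟨h1, h2⟩, h3, h4⟩
    exact ⟨⟨ha, hb, h1⟩, ⟨hx, fun i => (h2 i).symm⟩, ⟨h3, hy⟩, h4⟩
  · rintro ⟨⟨ha, hb, h1⟩, ⟨hx, h2⟩, ⟨h3, hy⟩, h4⟩
    exact ⟨⟨ha, hx⟩, ⟨hb, hy⟩, ⟨h1, fun i => Ne.symm (h2 i)⟩, h3, h4⟩

theorem pairProd_snoc {n k : ℕ} (a b : Fin k → Fin n) (x y : Fin n) :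
    pairProd (Fin.snoc a x : Fin (k + 1) → Fin n) (Fin.snoc b y : Fin (k + 1) → Fin n) =
      pairProd a b * (X x - X y) := by
  simp [pairProd, Fin.prod_univ_castSucc]

open Classical in
/-- Since each pair is annihilated by the sum of its two variables, only the letters outside the
pairs survive in `∑_{i < q} x_i`; there are `q - 2k` of them below `q`. -/
theorem adjoin_pairProd {n k : ℕ} {q : Fin n} {a b : Fin k → Fin n}
    (h : Function.Injective (Sum.elim a b)) (hlt : ∀ s, Sum.elim a b s < q) :
    adjoin q ((q : ℂ) - 2 * k) (pairProd a b) =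
      ∑ i ∈ Finset.Iio q with i ∉ Set.range (Sum.elim a b),
        pairProd (Fin.snoc a i : Fin (k + 1) → Fin n) (Fin.snoc b q : Fin (k + 1) → Fin n) := by
  have hq : q ∉ Set.range (Sum.elim a b) := by
    rintro ⟨s, hs⟩
    exact (hlt s).ne hs
  have himg : (Finset.Iio q).filter (fun i => i ∈ Set.range (Sum.elim a b)) =
      Finset.univ.image (Sum.elim a b) := by
    ext i
    simp only [Finset.mem_filter, Finset.mem_Iio, Finset.mem_image, Finset.mem_univ, true_and,
      Set.mem_range, and_iff_right_iff_imp]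
    rintro ⟨s, rfl⟩
    exact hlt s
  have hzero : ∑ i ∈ Finset.Iio q with i ∈ Set.range (Sum.elim a b), sqfreeMul i (pairProd a b)
      = 0 := by
    rw [himg, Finset.sum_image (fun _ _ _ _ e => h e), Fintype.sum_sum_type,
      ← Finset.sum_add_distrib]
    exact Finset.sum_eq_zero fun j _ => sqfreeMul_pairProd_add h j
  have hcard : (((Finset.Iio q).filter
      (fun i => i ∉ Set.range (Sum.elim a b))).card : ℂ) = (q : ℂ) - 2 * k := by
    have h1 := Finset.card_filter_add_card_filter_not (s := Finset.Iio q)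
      (fun i => i ∈ Set.range (Sum.elim a b))
    rw [himg, Finset.card_image_of_injective _ h, Fin.card_Iio, Finset.card_univ,
      Fintype.card_sum, Fintype.card_fin] at h1
    rw [← h1]; push_cast; ring
  simp only [pairProd_snoc, mul_sub]
  rw [Finset.sum_sub_distrib, Finset.sum_const, nsmul_eq_mul, adjoin, LinearMap.sub_apply,
    LinearMap.sum_apply, LinearMap.smul_apply, sqfreeMul_pairProd hq,
    ← Finset.sum_filter_add_sum_filter_not (Finset.Iio q)
      (fun i => i ∈ Set.range (Sum.elim a b)), hzero, zero_add]
  congr 1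
  · refine Finset.sum_congr rfl fun i hi => ?_
    rw [sqfreeMul_pairProd (Finset.mem_filter.1 hi).2, mul_comm]
  · rw [← hcard, smul_eq_C_mul, map_natCast]; ring

/-- The span of the products of `k` differences in `2k` distinct letters below `q`. -/
def pairSpan (n k q : ℕ) : Submodule ℂ (MvPolynomial (Fin n) ℂ) :=
  Submodule.span ℂ {f | ∃ a b : Fin k → Fin n, Function.Injective (Sum.elim a b) ∧
    (∀ s, ((Sum.elim a b s : Fin n) : ℕ) < q) ∧ f = pairProd a b}

theorem pairSpan_le_tensorModel (n k q : ℕ) : pairSpan n k q ≤ (tensorModel n k).toSubmodule := by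
  refine Submodule.span_le.2 ?_
  rintro _ ⟨a, b, h, -, rfl⟩
  exact pairProd_mem_tensorModel h

theorem adjoin_mem_pairSpan {n k r : ℕ} {q : Fin n} (hr : (q : ℕ) < r)
    {f : MvPolynomial (Fin n) ℂ} (hf : f ∈ pairSpan n k (q : ℕ)) :
    adjoin q ((q : ℂ) - 2 * k) f ∈ pairSpan n (k + 1) r := by
  classical
  induction hf using Submodule.span_induction with
  | mem f hf =>
    obtain ⟨a, b, h, hlt, rfl⟩ := hf
    rw [adjoin_pairProd h (fun s => Fin.lt_def.2 (hlt s))]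
    refine Submodule.sum_mem _ fun i hi => Submodule.subset_span ⟨_, _, ?_, ?_, rfl⟩
    · rw [Finset.mem_filter, Finset.mem_Iio] at hi
      refine injective_sumElim_snoc.2 ⟨h, hi.2, ?_, hi.1.ne⟩
      rintro ⟨s, hs⟩
      exact (hlt s).ne (congrArg Fin.val hs)
    · rw [Finset.mem_filter, Finset.mem_Iio, Fin.lt_def] at hi
      rintro (s | s)
      · refine Fin.lastCases ?_ (fun j => ?_) s
        · simp only [Sum.elim_inl, Fin.snoc_last]; omega
        · simpa using (hlt (Sum.inl j)).trans hr
      · refine Fin.lastCases ?_ (fun j => ?_) s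
        · simpa using hr
        · simpa using (hlt (Sum.inr j)).trans hr
  | zero => simp
  | add x y _ _ hx hy => rw [map_add]; exact Submodule.add_mem _ hx hy
  | smul c x _ hx => rw [map_smul]; exact Submodule.smul_mem _ c hx

open Classical in
theorem gtForm_eq_sum {n k : ℕ} (p : Fin k → Fin n) :
    gtForm p = ∑ i : Fin k → Fin n with
      (∀ j, i j < p j) ∧ Function.Injective (Sum.elim i p), pairProd i p := rfl

theorem gtForm_mem_pairSpan {n k q : ℕ} {p : Fin k → Fin n} (hp : ∀ j, (p j : ℕ) < q) :
    gtForm p ∈ pairSpan n k q := by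
  classical
  rw [gtForm_eq_sum]
  refine Submodule.sum_mem _ fun i hi => Submodule.subset_span ⟨i, p, ?_, ?_, rfl⟩
  · exact (Finset.mem_filter.1 hi).2.2
  · rintro (j | j)
    · exact lt_trans (Fin.lt_def.1 ((Finset.mem_filter.1 hi).2.1 j)) (hp j)
    · exact hp j

/-- Summing over the last index `i_{k+1}` first: modulo squares, the last letter `q` of the second
row contributes the single factor `∑_{i < q} x_i - (q - 2k) x_q` (`q` counts the letters below it,
as letters are counted from `0`). -/
theorem gtForm_snoc {n k : ℕ} {p : Fin k → Fin n} {q : Fin n} (hp : ∀ j, p j < q) :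
    gtForm (Fin.snoc p q : Fin (k + 1) → Fin n) = adjoin q ((q : ℂ) - 2 * k) (gtForm p) := by
  classical
  rw [gtForm_eq_sum, gtForm_eq_sum, map_sum, Finset.sum_filter,
    ← (Fin.snocEquiv fun _ : Fin (k + 1) => Fin n).sum_comp, Fintype.sum_prod_type_right,
    Finset.sum_filter]
  refine Finset.sum_congr rfl fun i _ => ?_
  have hs : ∀ x : Fin n, (Fin.snocEquiv fun _ : Fin (k + 1) => Fin n) (x, i) =
      (Fin.snoc i x : Fin (k + 1) → Fin n) := fun _ => rfl
  simp only [hs, injective_sumElim_snoc, Fin.forall_fin_succ', Fin.snoc_castSucc, Fin.snoc_last]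
  split_ifs with h
  · have hlt : ∀ s, Sum.elim i p s < q := by
      rintro (j | j)
      · exact (h.1 j).trans (hp j)
      · exact hp j
    have hq : q ∉ Set.range (Sum.elim i p) := by
      rintro ⟨s, hs⟩
      exact (hlt s).ne hs
    rw [adjoin_pairProd h.2 hlt, ← Finset.sum_filter]
    refine Finset.sum_congr ?_ fun _ _ => rfl
    ext x
    simp only [Finset.mem_filter, Finset.mem_univ, true_and, Finset.mem_Iio]
    exact ⟨fun hx => ⟨hx.1.2, hx.2.2.1⟩, fun hx => ⟨⟨h.1, hx.1⟩, h.2, hx.2, hq, hx.1.ne⟩⟩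
  · exact Finset.sum_eq_zero fun x _ => if_neg fun hx => h ⟨hx.1.1, hx.2.1⟩

/-- If `p_1 < ⋯ < p_m` are the letters of the second row that lie below `l`, then the product of
the factors that belong to `p_{m+1}, …, p_k` is an operator that commutes with the permutations of
the first `l` letters and takes a combination of products of `m` differences of these letters to
`F`. -/
theorem exists_operator_gtForm {n l m : ℕ} (d : ℕ) : ∀ {k r : ℕ} (_ : k = m + d)
    {p : Fin k → Fin n} (_ : StrictMono p) (_ : ∀ j, (p j : ℕ) < l ↔ (j : ℕ) < m) (_ : l ≤ r)
    (_ : ∀ j, (p j : ℕ) < r),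
    ∃ Φ : MvPolynomial (Fin n) ℂ →ₗ[ℂ] MvPolynomial (Fin n) ℂ,
      (∀ σ : Equiv.Perm (Fin n), (∀ i : Fin n, l ≤ i → σ i = i) →
        ∀ f, permRep n σ (Φ f) = Φ (permRep n σ f)) ∧
      (∀ f ∈ pairSpan n m l, Φ f ∈ pairSpan n k r) ∧
      ∃ f ∈ pairSpan n m l, Φ f = gtForm p := by
  induction d with
  | zero =>
    intro k r hk p hp hl hlr hr
    obtain rfl : k = m := hk
    refine ⟨LinearMap.id, fun _ _ _ => rfl, fun f hf => ?_, gtForm p, ?_, rfl⟩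
    · refine Submodule.span_mono ?_ hf
      rintro _ ⟨a, b, h, hs, rfl⟩
      exact ⟨a, b, h, fun s => (hs s).trans_le hlr, rfl⟩
    · exact gtForm_mem_pairSpan fun j => (hl j).2 j.2
  | succ d ih =>
    intro k r hk p hp hl hlr hr
    obtain rfl : k = (m + d) + 1 := hk
    have hlast : l ≤ p (Fin.last _) := by
      by_contra! h
      have := (hl _).1 h
      simp at this
    have hmono : ∀ j : Fin (m + d), p j.castSucc < p (Fin.last _) :=
      fun j => hp (Fin.castSucc_lt_last j)
    obtain ⟨Φ, h1, h2, f, hf, h3⟩ := ih (r := p (Fin.last _)) rfl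
      (p := fun j => p j.castSucc) (fun i j hij => hp (by simpa using hij))
      (fun j => hl j.castSucc) hlast hmono
    refine ⟨adjoin (p (Fin.last _)) (((p (Fin.last _) : ℕ) : ℂ) - 2 * ((m + d : ℕ) : ℂ)) ∘ₗ Φ,
      fun σ hσ g => ?_, fun g hg => ?_, f, hf, ?_⟩
    · rw [LinearMap.comp_apply, LinearMap.comp_apply, permRep_adjoin hlast _ hσ, h1 σ hσ]
    · have h := h2 g hg
      rw [LinearMap.comp_apply]
      exact adjoin_mem_pairSpan (k := m + d) (q := p (Fin.last (m + d))) (hr (Fin.last _)) h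
    · have h4 := gtForm_snoc (p := fun j => p j.castSucc) hmono
      have h5 : (Fin.snoc (fun j => p j.castSucc) (p (Fin.last _)) : Fin (m + d + 1) → Fin n) = p :=
        Fin.snoc_init_self p
      rw [h5] at h4
      rw [LinearMap.comp_apply, h3, h4]

/-- The value at the indicator of the second row: every summand of `F` takes the value `(-1)^k`
there. -/
theorem gtForm_ne_zero {n k : ℕ} {p i : Fin k → Fin n} (hlt : ∀ j, i j < p j)
    (hi : Function.Injective (Sum.elim i p)) : gtForm p ≠ 0 := by
  classical
  intro h0
  have h := congrArg (eval fun a => if a ∈ Set.range p then (1 : ℂ) else 0) h0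
  rw [gtForm_eq_sum, map_sum, map_zero, Finset.sum_congr rfl (g := fun _ => (-1 : ℂ) ^ k),
    Finset.sum_const, nsmul_eq_mul] at h
  · have hne : (-1 : ℂ) ^ k ≠ 0 := pow_ne_zero _ (by norm_num)
    have hc := (mul_eq_zero.1 h).resolve_right hne
    rw [Nat.cast_eq_zero, Finset.card_eq_zero] at hc
    have hm : i ∈ Finset.univ.filter
      (fun i => (∀ j, i j < p j) ∧ Function.Injective (Sum.elim i p)) := 
      Finset.mem_filter.2 ⟨Finset.mem_univ _, hlt, hi⟩
    rw [hc] at hm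
    simp at hm
  · intro a ha
    have hinj := (Finset.mem_filter.1 ha).2.2
    rw [pairProd, map_prod, Finset.prod_congr rfl (g := fun _ => (-1 : ℂ))]
    · simp
    · intro j _
      have h1 : a j ∉ Set.range p := by
        rintro ⟨s, hs⟩
        exact absurd (@hinj (Sum.inr s) (Sum.inl j) hs) (by simp)
      rw [map_sub, eval_X, eval_X, if_neg h1, if_pos (Set.mem_range_self j), zero_sub]

/-! ### Diagrams with two rows -/

theorem mem_cells_of_lt_rowLen {μ : YoungDiagram} {i j : ℕ} (h : j < μ.rowLen i) :
    (i, j) ∈ μ.cells := (YoungDiagram.mem_cells _).2 (YoungDiagram.mem_iff_lt_rowLen.2 h)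

theorem lt_rowLen_of_mem_cells {μ : YoungDiagram} {c : ℕ × ℕ} (h : c ∈ μ.cells) :
    c.2 < μ.rowLen c.1 := YoungDiagram.mem_iff_lt_rowLen.1 ((YoungDiagram.mem_cells _).1 h)

theorem card_cells_of_two_rows {μ : YoungDiagram} (hμ : ∀ c ∈ μ.cells, c.1 < 2) :
    μ.cells.card = μ.rowLen 0 + μ.rowLen 1 := by
  rw [μ.rowLen_eq_card, μ.rowLen_eq_card, YoungDiagram.row, YoungDiagram.row,
    ← Finset.card_filter_add_card_filter_not (s := μ.cells) (fun c => c.1 = 0)]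
  congr 2
  refine Finset.filter_congr fun c hc => ?_
  have := hμ c hc
  omega

theorem two_mul_rowLen_one_le {μ : YoungDiagram} (hμ : ∀ c ∈ μ.cells, c.1 < 2) :
    2 * μ.rowLen 1 ≤ μ.cells.card := by
  have := μ.rowLen_anti 0 1 zero_le_one
  rw [card_cells_of_two_rows hμ]
  omega

/-- The cell `(i, j)` of a diagram whose second row has more than `j` cells, for `i ≤ 1`. -/
def pairCell {μ : YoungDiagram} (i : ℕ) (hi : i ≤ 1) (j : Fin (μ.rowLen 1)) : μ.cells :=
  ⟨(i, j), mem_cells_of_lt_rowLen (j.2.trans_le (μ.rowLen_anti _ _ hi))⟩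

theorem injective_pairCell {μ : YoungDiagram} :
    Function.Injective (Sum.elim (pairCell (μ := μ) 0 zero_le_one) (pairCell 1 le_rfl)) := by
  have h : ∀ i hi i' hi' (j j' : Fin (μ.rowLen 1)), pairCell i hi j = pairCell i' hi' j' →
      i = i' ∧ j = j' := by
    intro i hi i' hi' j j' e
    have := congrArg Subtype.val e
    exact ⟨congrArg Prod.fst this, Fin.ext (congrArg Prod.snd this)⟩
  rw [Sum.elim_injective]
  exact ⟨fun _ _ e => (h _ _ _ _ _ _ e).2, fun _ _ e => (h _ _ _ _ _ _ e).2,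
    fun _ _ e => zero_ne_one (h _ _ _ _ _ _ e).1⟩

theorem spechtPolynomial_eq_pairProd {l : ℕ} {μ : YoungDiagram} (hμ : ∀ c ∈ μ.cells, c.1 < 2)
    (t : μ.cells ≃ Fin l) :
    spechtPolynomial t = pairProd (fun j => t (pairCell 0 zero_le_one j))
      (fun j => t (pairCell 1 le_rfl j)) := by
  rw [spechtPolynomial, pairProd, Finset.prod_sigma']
  symm
  refine Finset.prod_nbij
    (fun j => ⟨pairCell 0 zero_le_one j, pairCell 1 le_rfl j⟩) ?_ ?_ ?_ (fun _ _ => rfl)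
  · intro j _
    simp [pairCell]
  · intro j _ j' _ h
    have h1 := congrArg (fun x : (_ : μ.cells) × μ.cells => x.1) h
    exact Sum.inl_injective (injective_pairCell (a₁ := Sum.inl j) (a₂ := Sum.inl j') h1)
  · rintro ⟨c, d⟩ h
    simp only [Finset.coe_sigma, Set.mem_sigma_iff, Finset.coe_filter, Finset.mem_univ, true_and,
      Set.mem_ofPred_eq] at h
    obtain ⟨-, h1, h2⟩ := h
    have hd := hμ _ d.2
    have h3 : d.1.1 = 1 := by omega
    have h4 : c.1.1 = 0 := by omega
    have h5 := lt_rowLen_of_mem_cells d.2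
    rw [h3] at h5
    refine ⟨⟨d.1.2, h5⟩, by simp, ?_⟩
    have hc : pairCell 0 zero_le_one ⟨d.1.2, h5⟩ = c := Subtype.ext (Prod.ext h4.symm h1.symm)
    have hd' : pairCell 1 le_rfl ⟨d.1.2, h5⟩ = d := Subtype.ext (Prod.ext h3.symm rfl)
    simp only [hc, hd']

/-- The Specht polynomials of a diagram with two rows are the products of differences in disjoint
pairs of letters: the letters outside the pairs fill the remaining cells of the first row. -/
theorem specht_eq_pairSpan {l : ℕ} {μ : YoungDiagram} (hμ : ∀ c ∈ μ.cells, c.1 < 2)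
    (hl : μ.cells.card = l) : (specht l μ).toSubmodule = pairSpan l (μ.rowLen 1) l := by
  apply le_antisymm
  · refine Submodule.span_le.2 ?_
    rintro _ ⟨t, rfl⟩
    rw [spechtPolynomial_eq_pairProd hμ]
    refine Submodule.subset_span ⟨_, _, ?_, fun s => Fin.is_lt _, rfl⟩
    have := t.injective.comp injective_pairCell
    rwa [Sum.comp_elim] at this
  · refine Submodule.span_le.2 ?_
    rintro _ ⟨a, b, h, -, rfl⟩
    classical
    let φ : Fin (μ.rowLen 1) ⊕ Fin (μ.rowLen 1) → μ.cells :=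
      Sum.elim (pairCell 0 zero_le_one) (pairCell 1 le_rfl)
    have hφ : Function.Injective φ := injective_pairCell
    rcases isEmpty_or_nonempty (Fin (μ.rowLen 1) ⊕ Fin (μ.rowLen 1)) with hE | hE
    · obtain ⟨t⟩ : Nonempty (μ.cells ≃ Fin l) := by
        rw [← Fintype.card_eq]; simpa using hl
      refine Submodule.subset_span ⟨t, ?_⟩
      rw [spechtPolynomial_eq_pairProd hμ]
      have hE' : IsEmpty (Fin (μ.rowLen 1)) := (isEmpty_sum.1 hE).1
      simp [pairProd]
    · obtain ⟨g, hg⟩ := Set.MapsTo.exists_equiv_extend_of_card_eq (α := μ.cells)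
        (t := (Finset.univ : Finset (Fin l))) (s := Set.range φ)
        (f := fun c => Sum.elim a b (Function.invFun φ c)) (by simpa using hl)
        (fun _ _ => Finset.mem_coe.2 (Finset.mem_univ _)) (by
          rintro _ ⟨s, rfl⟩ _ ⟨s', rfl⟩ e
          simp only [Function.leftInverse_invFun hφ _] at e
          rw [h e])
      refine Submodule.subset_span
        ⟨g.trans (Equiv.subtypeUnivEquiv fun x => Finset.mem_univ x), ?_⟩
      have key : ∀ s, ((g (φ s) : Fin l)) = Sum.elim a b s := fun s => by
        rw [hg _ ⟨s, rfl⟩, Function.leftInverse_invFun hφ]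
      rw [spechtPolynomial_eq_pairProd hμ]
      congr 1
      · exact funext fun j => key (Sum.inl j)
      · exact funext fun j => key (Sum.inr j)

/-! ### Standard tableaux with two rows -/

namespace Tableau

variable {n : ℕ} {μ : YoungDiagram}

theorem card_cells (u : Tableau n μ) : μ.cells.card = n := by
  simpa using (Fintype.card_congr u.cell).symm

theorem injective_val_cell (u : Tableau n μ) : Function.Injective fun a => (u.cell a).1 :=
  Subtype.val_injective.comp u.cell.injective

theorem shape_cells (u : Tableau n μ) (l : ℕ) : (u.shape l).cells =
    (Finset.univ.filter fun a : Fin n => (a : ℕ) < l).image fun a => (u.cell a).1 := rfl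

theorem shape_cells_subset (u : Tableau n μ) (l : ℕ) : (u.shape l).cells ⊆ μ.cells := by
  intro c hc
  obtain ⟨a, -, rfl⟩ := Finset.mem_image.1 hc
  exact (u.cell a).2

theorem card_shape (u : Tableau n μ) {l : ℕ} (hl : l ≤ n) : (u.shape l).cells.card = l := by
  rw [shape_cells, Finset.card_image_of_injective _ u.injective_val_cell]
  have : Finset.univ.filter (fun a : Fin n => (a : ℕ) < l) =
      (Finset.univ : Finset (Fin l)).map (Fin.castLEEmb hl) := by
    ext a
    simp only [Finset.mem_filter, Finset.mem_univ, true_and, Finset.mem_map]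
    exact ⟨fun h => ⟨⟨a, h⟩, rfl⟩, by rintro ⟨b, rfl⟩; exact b.2⟩
  rw [this]
  simp

theorem rowLen_shape (u : Tableau n μ) (l i : ℕ) :
    (u.shape l).rowLen i =
      (Finset.univ.filter fun a : Fin n => (a : ℕ) < l ∧ (u.cell a).1.1 = i).card := by
  rw [YoungDiagram.rowLen_eq_card, YoungDiagram.row, shape_cells, Finset.filter_image,
    Finset.card_image_of_injective _ u.injective_val_cell, Finset.filter_filter]

theorem rowLen_eq (u : Tableau n μ) (i : ℕ) :
    μ.rowLen i = (Finset.univ.filter fun a : Fin n => (u.cell a).1.1 = i).card := by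
  have : μ = u.shape n := by
    refine YoungDiagram.ext (Finset.Subset.antisymm ?_ (u.shape_cells_subset n))
    intro c hc
    obtain ⟨a, ha⟩ := u.cell.surjective ⟨c, hc⟩
    exact Finset.mem_image.2 ⟨a, by simp, by rw [ha]⟩
  rw [show μ.rowLen i = (u.shape n).rowLen i from congrArg (fun ν => ν.rowLen i) this,
    rowLen_shape]
  simp

/-- The column of a letter is the number of smaller letters in its row. -/
theorem col_eq (u : Tableau n μ) (a : Fin n) :
    (u.cell a).1.2 =
      (Finset.univ.filter fun b : Fin n => b < a ∧ (u.cell b).1.1 = (u.cell a).1.1).card := by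
  rw [← Finset.card_range (u.cell a).1.2]
  symm
  refine Finset.card_nbij (fun b => (u.cell b).1.2) ?_ ?_ ?_
  · intro b hb
    simp only [Finset.coe_filter, Finset.mem_univ, true_and, Set.mem_ofPred_eq] at hb
    simp only [Finset.coe_range, Set.mem_Iio]
    by_contra! h
    exact absurd (u.le_of_cell_le (Prod.le_def.2 ⟨hb.2.ge, h⟩)) hb.1.not_ge
  · intro b hb b' hb' h
    simp only [Finset.coe_filter, Finset.mem_univ, true_and, Set.mem_ofPred_eq] at hb hb'
    exact u.cell.injective (Subtype.ext (Prod.ext (hb.2.trans hb'.2.symm) h))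
  · intro j hj
    simp only [Finset.coe_range, Set.mem_Iio] at hj
    have hc : ((u.cell a).1.1, j) ∈ μ.cells :=
      μ.isLowerSet (Prod.mk_le_mk.2 ⟨le_rfl, hj.le⟩) (u.cell a).2
    obtain ⟨b, hb⟩ := u.cell.surjective ⟨_, hc⟩
    refine ⟨b, ?_, by simp only [hb]⟩
    simp only [Finset.coe_filter, Finset.mem_univ, true_and, Set.mem_ofPred_eq]
    exact ⟨u.row_increasing b a (by rw [hb]) (by rw [hb]; exact hj), by rw [hb]⟩

theorem eq_of_cell_eq {u v : Tableau n μ} (h : ∀ a, (u.cell a).1 = (v.cell a).1) : u = v := by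
  have : u.cell = v.cell := Equiv.ext fun a => Subtype.ext (h a)
  cases u; cases v; simpa using this

theorem row_lt_two (hμ : ∀ c ∈ μ.cells, c.1 < 2) (u : Tableau n μ) (a : Fin n) :
    (u.cell a).1.1 < 2 := hμ _ (u.cell a).2

/-- A tableau with two rows is determined by its second row, hence by the numbers of letters of
the second row among the first `l` letters. -/
theorem eq_of_rowLen_shape_eq (hμ : ∀ c ∈ μ.cells, c.1 < 2) {u v : Tableau n μ}
    (h : ∀ l ≤ n, (u.shape l).rowLen 1 = (v.shape l).rowLen 1) : u = v := by
  classical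
  have hrow : ∀ a : Fin n, (u.cell a).1.1 = 1 ↔ (v.cell a).1.1 = 1 := by
    have hsucc : ∀ (w : Tableau n μ) (a : Fin n), (w.shape (a + 1)).rowLen 1 =
        (w.shape a).rowLen 1 + if (w.cell a).1.1 = 1 then 1 else 0 := by
      intro w a
      rw [rowLen_shape, rowLen_shape]
      split_ifs with hw
      · rw [← Finset.card_insert_of_notMem (a := a) (by simp)]
        congr 1
        ext b
        simp only [Finset.mem_filter, Finset.mem_univ, true_and, Finset.mem_insert, Fin.ext_iff]
        constructor
        · rintro ⟨h1, h2⟩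
          by_cases hb : (b : ℕ) = a
          · exact Or.inl hb
          · exact Or.inr ⟨by omega, h2⟩
        · rintro (hb | ⟨h1, h2⟩)
          · obtain rfl := Fin.ext hb
            exact ⟨by omega, hw⟩
          · exact ⟨by omega, h2⟩
      · rw [add_zero]
        congr 1
        ext b
        simp only [Finset.mem_filter, Finset.mem_univ, true_and]
        constructor
        · rintro ⟨h1, h2⟩
          have : b ≠ a := fun e => hw (e ▸ h2)
          rw [Ne, Fin.ext_iff] at this
          exact ⟨by omega, h2⟩
        · rintro ⟨h1, h2⟩
          exact ⟨by omega, h2⟩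
    intro a
    have h1 := hsucc u a
    have h2 := hsucc v a
    rw [h _ a.2, h _ a.2.le, h2] at h1
    split_ifs at h1 <;> simp_all
  have hrow' : ∀ a : Fin n, (u.cell a).1.1 = (v.cell a).1.1 := by
    intro a
    have h1 := hrow a
    have h2 := u.row_lt_two hμ a
    have h3 := v.row_lt_two hμ a
    omega
  refine eq_of_cell_eq fun a => Prod.ext (hrow' a) ?_
  rw [u.col_eq, v.col_eq]
  simp only [hrow']

theorem two_mul_rowLen_shape_le (hμ : ∀ c ∈ μ.cells, c.1 < 2) (u : Tableau n μ) {l : ℕ}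
    (hl : l ≤ n) : 2 * (u.shape l).rowLen 1 ≤ l := by
  have := two_mul_rowLen_one_le fun c hc => hμ c (u.shape_cells_subset l hc)
  rwa [u.card_shape hl] at this

/-- The letters above the letters of the second row, in the same columns. -/
theorem exists_above (u : Tableau n μ) {k : ℕ} {p : Fin k → Fin n} (hp : Function.Injective p)
    (hrow : ∀ j, (u.cell (p j)).1.1 = 1) :
    ∃ i : Fin k → Fin n, (∀ j, i j < p j) ∧ Function.Injective (Sum.elim i p) := by
  have hmem : ∀ j, (0, (u.cell (p j)).1.2) ∈ μ.cells := fun j =>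
    μ.isLowerSet (Prod.mk_le_mk.2 ⟨Nat.zero_le _, le_rfl⟩) (u.cell (p j)).2
  obtain ⟨i, hi⟩ : ∃ i : Fin k → Fin n, ∀ j, (u.cell (i j)).1 = (0, (u.cell (p j)).1.2) :=
    ⟨fun j => u.cell.symm ⟨_, hmem j⟩, fun j => by rw [Equiv.apply_symm_apply]⟩
  refine ⟨i, fun j => u.col_increasing _ _ (by rw [hi]) (by rw [hi, hrow]; exact zero_lt_one), ?_⟩
  rw [Sum.elim_injective]
  refine ⟨fun j j' e => hp (u.cell.injective (Subtype.ext (Prod.ext ?_ ?_))), hp, fun j j' e => ?_⟩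
  · rw [hrow, hrow]
  · have h := hi j
    rw [e, hi] at h
    exact (congrArg Prod.snd h).symm
  · have h := congrArg Prod.fst (hi j)
    rw [e, hrow] at h
    exact one_ne_zero h

/-- As `p` is increasing, the letters of the second row below `l` are its first values; their number
is the length of the second row of the diagram of the first `l` letters. -/
theorem lt_iff_lt_rowLen_shape (u : Tableau n μ) {k : ℕ} {p : Fin k → Fin n} (hp : StrictMono p)
    (hrow : Set.range p = u.row 1) (l : ℕ) (j : Fin k) :
    (p j : ℕ) < l ↔ (j : ℕ) < (u.shape l).rowLen 1 := by
  classical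
  have hcard : (u.shape l).rowLen 1 = (Finset.univ.filter fun i => (p i : ℕ) < l).card := by
    rw [rowLen_shape, ← Finset.card_map ⟨p, hp.injective⟩]
    congr 1
    ext a
    simp only [Finset.mem_filter, Finset.mem_univ, true_and, Finset.mem_map,
      Function.Embedding.coeFn_mk]
    have ha : (u.cell a).1.1 = 1 ↔ a ∈ Set.range p := by rw [hrow]; rfl
    rw [ha]
    constructor
    · rintro ⟨h1, i, rfl⟩
      exact ⟨i, h1, rfl⟩
    · rintro ⟨i, h1, rfl⟩
      exact ⟨h1, i, rfl⟩
  rw [hcard]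
  constructor
  · intro h
    have : (Finset.Iic j).card ≤ (Finset.univ.filter fun i => (p i : ℕ) < l).card := by
      refine Finset.card_le_card fun i hi => ?_
      rw [Finset.mem_Iic] at hi
      simpa using lt_of_le_of_lt (Fin.le_def.1 (hp.monotone hi)) h
    rw [Fin.card_Iic] at this
    omega
  · intro h
    by_contra! hj
    have : (Finset.univ.filter fun i => (p i : ℕ) < l).card ≤ (Finset.Iio j).card := by
      refine Finset.card_le_card fun i hi => ?_
      rw [Finset.mem_Iio]
      by_contra! hi'
      have := Fin.le_def.1 (hp.monotone hi')
      simp only [Finset.mem_filter, Finset.mem_univ, true_and] at hi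
      omega
    rw [Fin.card_Iio] at this
    omega

/-- Every set of letters with the ballot property is the second row of a tableau. -/
theorem exists_of_ballot (hμ : ∀ c ∈ μ.cells, c.1 < 2) (hn : μ.cells.card = n)
    {P : Finset (Fin n)} (hP : P.card = μ.rowLen 1)
    (hb : ∀ l ≤ n, 2 * (P.filter fun a : Fin n => (a : ℕ) < l).card ≤ l) :
    ∃ u : Tableau n μ, ∀ a, (u.cell a).1.1 = 1 ↔ a ∈ P := by
  classical
  -- the letter `a` goes to its row, to the right of the smaller letters of that row
  let S : Fin n → Finset (Fin n) := fun a => Finset.univ.filter fun b => b ∈ P ↔ a ∈ P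
  let col : Fin n → ℕ := fun a => ((S a).filter fun b => b < a).card
  let r : Fin n → ℕ := fun a => if a ∈ P then 1 else 0
  have hr : ∀ a b, r a = r b ↔ (a ∈ P ↔ b ∈ P) := by
    intro a b
    by_cases ha : a ∈ P <;> by_cases hb : b ∈ P <;> simp [r, ha, hb]
  have hS : ∀ a b, r a = r b → S a = S b := by
    intro a b h
    ext c
    simp only [S, Finset.mem_filter, (hr a b).1 h]
  have hself : ∀ a, a ∈ S a := fun a => by simp [S]
  have hcol : ∀ a b, r a = r b → a < b → col a < col b := by
    intro a b h hab
    simp only [col, ← hS a b h]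
    refine Finset.card_lt_card (Finset.ssubset_iff_of_subset ?_ |>.2 ⟨a, ?_, ?_⟩)
    · intro c hc
      rw [Finset.mem_filter] at hc ⊢
      exact ⟨hc.1, hc.2.trans hab⟩
    · exact Finset.mem_filter.2 ⟨hself a, hab⟩
    · simp
  have hmono : ∀ a b, r a = r b → col a < col b → a < b := by
    intro a b h hlt
    by_contra! hba
    rcases hba.lt_or_eq with hba | rfl
    · exact (hcol b a h.symm hba).not_gt hlt
    · exact lt_irrefl _ hlt
  have hP' : (Finset.univ.filter fun a => a ∉ P).card = μ.rowLen 0 := by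
    have h1 := card_cells_of_two_rows hμ
    have h2 := Finset.card_compl P
    rw [Fintype.card_fin, Finset.compl_eq_univ_sdiff, Finset.sdiff_eq_filter] at h2
    omega
  have hmem : ∀ a, (r a, col a) ∈ μ.cells := by
    intro a
    refine mem_cells_of_lt_rowLen ?_
    have hlt : col a < (S a).card := Finset.card_lt_card
      (Finset.ssubset_iff_of_subset (Finset.filter_subset _ _) |>.2 ⟨a, hself a, by simp⟩)
    by_cases ha : a ∈ P
    · have : S a = P := by ext; simp [S, ha]
      rw [this, hP] at hlt
      simpa [r, ha] using hlt
    · have : S a = Finset.univ.filter fun a => a ∉ P := by ext; simp [S, ha]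
      rw [this, hP'] at hlt
      simpa [r, ha] using hlt
  have hinj : Function.Injective fun a => (⟨(r a, col a), hmem a⟩ : μ.cells) := by
    intro a b h
    have h0 := congrArg Subtype.val h
    have h1 : r a = r b := congrArg Prod.fst h0
    have h2 : col a = col b := congrArg Prod.snd h0
    rcases lt_trichotomy a b with h | h | h
    · exact absurd h2 (hcol a b h1 h).ne
    · exact h
    · exact absurd h2 (hcol b a h1.symm h).ne'
  have hbij := (Fintype.bijective_iff_injective_and_card _).2 ⟨hinj, by simp [hn]⟩
  refine ⟨⟨Equiv.ofBijective _ hbij, fun a b h1 h2 => hmono a b h1 h2, fun a b h1 h2 => ?_⟩,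
    fun a => ?_⟩
  · simp only [Equiv.ofBijective_apply] at h1 h2
    have hb1 : b ∈ P := by
      by_contra hb'
      simp [r, hb'] at h2
    have ha1 : a ∉ P := by
      intro ha'
      simp [r, ha', hb1] at h2
    by_contra! hba
    have hba : b < a := lt_of_le_of_ne hba fun e => ha1 (e ▸ hb1)
    -- among the letters `≤ b`, those of the second row are `col b + 1` in number, so at least as
    -- many lie in the first row
    have e1 : (P.filter fun c : Fin n => (c : ℕ) < b + 1).card = col b + 1 := by
      simp only [col]
      rw [← Finset.card_insert_of_notMem (a := b) (by simp)]
      congr 1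
      ext c
      simp only [Finset.mem_filter, Finset.mem_insert, S, Finset.mem_univ, true_and, hb1,
        iff_true, Nat.lt_succ_iff_lt_or_eq, ← Fin.lt_def, ← Fin.ext_iff]
      constructor
      · rintro ⟨h1, h2 | h2⟩
        exacts [Or.inr ⟨h1, h2⟩, Or.inl h2]
      · rintro (rfl | ⟨h1, h2⟩)
        exacts [⟨hb1, Or.inr rfl⟩, ⟨h1, Or.inl h2⟩]
    have e2 : (Finset.Iic b).card ≤ (P.filter fun c : Fin n => (c : ℕ) < b + 1).card + col a := by
      refine (Finset.card_le_card ?_).trans (Finset.card_union_le _ _)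
      intro c hc
      rw [Finset.mem_Iic] at hc
      by_cases hcP : c ∈ P
      · exact Finset.mem_union_left _ (Finset.mem_filter.2 ⟨hcP, Nat.lt_succ_of_le hc⟩)
      · exact Finset.mem_union_right _ (Finset.mem_filter.2
          ⟨by simp [S, hcP, ha1], lt_of_le_of_lt hc hba⟩)
    have e3 := hb (b + 1) b.2
    rw [Fin.card_Iic] at e2
    omega
  · by_cases ha : a ∈ P <;> simp [r, ha]

instance : Finite (Tableau n μ) :=
  Finite.of_injective (fun u : Tableau n μ => u.cell) fun u v h =>
    eq_of_cell_eq fun a => by rw [show u.cell = v.cell from h]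

end Tableau

/-! ### Joint eigenvectors -/

section JointEigenvectors

variable {K V ι Λ : Type*} [Field K] [AddCommGroup V] [Module K V]

/-- If `i ↦ e i` is injective, then a relation can be shortened by applying `T l - e a l`, for an
`l` that separates `a` from another index. -/
theorem linearIndependent_of_joint_eigenvectors {x : ι → V} (hx : ∀ i, x i ≠ 0)
    (T : Λ → V →ₗ[K] V) (e : ι → Λ → K) (hT : ∀ i l, T l (x i) = e i l • x i)
    (he : Function.Injective e) : LinearIndependent K x := by
  classical
  rw [linearIndependent_iff']
  intro s
  induction s using Finset.induction_on with
  | empty => simp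
  | insert a s ha ih =>
    intro g hg
    have hs : ∀ i ∈ s, g i = 0 := by
      intro i hi
      obtain ⟨l, hl⟩ := Function.ne_iff.1 (he.ne (fun h => ha (h ▸ hi) : i ≠ a))
      have h1 := congrArg (fun v => T l v - e a l • v) hg
      simp only [map_sum, map_smul, hT, Finset.smul_sum, smul_comm (e a l), map_zero, smul_zero,
        sub_zero, ← Finset.sum_sub_distrib, ← smul_sub, ← sub_smul] at h1
      rw [Finset.sum_insert ha, sub_self, zero_smul, smul_zero, zero_add] at h1
      simp only [smul_smul] at h1
      exact (mul_eq_zero.1 (ih _ h1 i hi)).resolve_right (sub_ne_zero.2 hl)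
    rw [Finset.sum_insert ha, Finset.sum_eq_zero (fun i hi => by rw [hs i hi, zero_smul]),
      add_zero] at hg
    intro i hi
    rcases Finset.mem_insert.1 hi with rfl | hi
    · exact (smul_eq_zero.1 hg).resolve_right (hx _)
    · exact hs i hi

/-- In a basis of joint eigenvectors with distinct systems of eigenvalues, the joint eigenspaces
are lines. -/
theorem eq_smul_of_joint_eigenvector (b : Module.Basis ι K V) (T : Λ → V →ₗ[K] V)
    (e : ι → Λ → K) (hT : ∀ i l, T l (b i) = e i l • b i) (he : Function.Injective e) {i : ι}
    {v : V} (hv : ∀ l, T l v = e i l • v) : v = b.repr v i • b i := by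
  classical
  have hcoord : ∀ l j w, b.repr (T l w) j = e j l * b.repr w j := by
    intro l j w
    have : b.coord j ∘ₗ T l = e j l • b.coord j := by
      refine b.ext fun j' => ?_
      simp only [LinearMap.comp_apply, hT, map_smul, LinearMap.smul_apply, Module.Basis.coord_apply,
        Module.Basis.repr_self, smul_eq_mul, Finsupp.single_apply]
      split_ifs with h
      · rw [h]
      · simp
    exact LinearMap.congr_fun this w
  refine b.ext_elem fun j => ?_
  rw [map_smul, Finsupp.smul_apply, b.repr_self, smul_eq_mul, Finsupp.single_apply]
  split_ifs with h
  · rw [h, mul_one]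
  · obtain ⟨l, hl⟩ := Function.ne_iff.1 (he.ne h)
    have h1 := hcoord l j v
    rw [hv, map_smul, Finsupp.smul_apply, smul_eq_mul] at h1
    rw [mul_zero]
    exact (mul_eq_zero.1 (by linear_combination h1 :
      (e i l - e j l) * b.repr v j = 0)).resolve_left (sub_ne_zero.2 hl)

end JointEigenvectors

/-! ### Gelfand–Tsetlin subspaces -/

section GelfandTsetlin

variable {n k : ℕ} {μ : YoungDiagram}

/-- The sum over all ordered pairs `(i, j)` of letters below `l` of the transpositions `(i j)`,
acting in a representation of the symmetric group on `n` letters. -/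
def swapSum {V : Type*} [AddCommGroup V] [Module ℂ V]
    (ρ : Representation ℂ (Equiv.Perm (Fin n)) V) {l : ℕ} (hl : l ≤ n) : V →ₗ[ℂ] V :=
  ∑ i, ∑ j, restrict ρ hl (Equiv.swap i j)

theorem swapSum_of_mem_isotypic {V : Type*} [AddCommGroup V] [Module ℂ V]
    (ρ : Representation ℂ (Equiv.Perm (Fin n)) V) {l : ℕ} (hl : l ≤ n) {ν : YoungDiagram}
    (hν : ∀ c ∈ ν.cells, c.1 < 2) (hcard : ν.cells.card = l) {v : V}
    (hv : v ∈ isotypic (restrict ρ hl) (specht l ν).toRepresentation) :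
    swapSum ρ hl v = swapEigenvalue l (ν.rowLen 1) • v := by
  have hle : isotypic (restrict ρ hl) (specht l ν).toRepresentation ≤
      LinearMap.ker (swapSum ρ hl - swapEigenvalue l (ν.rowLen 1) • LinearMap.id) := by
    refine iSup_le fun f => ?_
    rintro _ ⟨w, rfl⟩
    have hw : w.1 ∈ (tensorModel l (ν.rowLen 1)).toSubmodule :=
      pairSpan_le_tensorModel _ _ l (by rw [← specht_eq_pairSpan hν hcard]; exact w.2)
    have h1 : ∑ i, ∑ j, (specht l ν).toRepresentation (Equiv.swap i j) w =
        swapEigenvalue l (ν.rowLen 1) • w := by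
      refine Subtype.ext ?_
      rw [Submodule.coe_smul, ← sum_swap_apply hw, Submodule.coe_sum]
      simp only [Submodule.coe_sum]
      rfl
    have h2 : ∀ σ, f.toLinearMap ((specht l ν).toRepresentation σ w) =
        restrict ρ hl σ (f.toLinearMap w) := fun σ => LinearMap.congr_fun (f.isIntertwining' σ) w
    rw [LinearMap.mem_ker, LinearMap.sub_apply, LinearMap.smul_apply, LinearMap.id_apply, sub_eq_zero,
      ← map_smul, ← h1]
    simp only [swapSum, LinearMap.sum_apply, map_sum, h2]
  have := hle hv
  rwa [LinearMap.mem_ker, LinearMap.sub_apply, LinearMap.smul_apply, LinearMap.id_apply,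
    sub_eq_zero] at this

theorem swapSum_of_mem_gtSubspace (hμ : ∀ c ∈ μ.cells, c.1 < 2) {V : Type*} [AddCommGroup V]
    [Module ℂ V] (ρ : Representation ℂ (Equiv.Perm (Fin n)) V) {u : Tableau n μ} {v : V}
    (hv : v ∈ gtSubspace ρ u) {l : ℕ} (hl : l ≤ n) :
    swapSum ρ hl v = swapEigenvalue l ((u.shape l).rowLen 1) • v := by
  refine swapSum_of_mem_isotypic ρ hl (fun c hc => hμ c (u.shape_cells_subset l hc))
    (u.card_shape hl) ?_
  simp only [gtSubspace, Submodule.mem_iInf] at hv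
  exact hv l hl

theorem gtForm_mem_tensorModel (p : Fin k → Fin n) :
    gtForm p ∈ (tensorModel n k).toSubmodule :=
  pairSpan_le_tensorModel n k n (gtForm_mem_pairSpan fun j => (p j).2)

/-- The operator of `exists_operator_gtForm`, restricted to the Specht module of the diagram of the
first `l` letters, is an intertwining map whose image contains `F`. -/
theorem gtForm_mem_gtSubspace (hμ : ∀ c ∈ μ.cells, c.1 < 2) (u : Tableau n μ)
    {p : Fin k → Fin n} (hp : StrictMono p) (hrow : Set.range p = u.row 1)
    (hk : μ.rowLen 1 = k) :
    (⟨gtForm p, gtForm_mem_tensorModel p⟩ : (tensorModel n k).toSubmodule) ∈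
      gtSubspace (tensorModel n k).toRepresentation u := by
  simp only [gtSubspace, Submodule.mem_iInf]
  intro l hl
  have hν : ∀ c ∈ (u.shape l).cells, c.1 < 2 := fun c hc => hμ c (u.shape_cells_subset l hc)
  have hspecht := specht_eq_pairSpan hν (u.card_shape hl)
  have hmk : (u.shape l).rowLen 1 ≤ k := by
    rw [← hk, u.rowLen_shape, u.rowLen_eq]
    exact Finset.card_le_card (Finset.monotone_filter_right _ fun _ _ h => h.2)
  have hlt := u.lt_iff_lt_rowLen_shape hp hrow l
  generalize (u.shape l).rowLen 1 = m at hspecht hmk hlt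
  obtain ⟨d, hd⟩ := Nat.exists_eq_add_of_le hmk
  obtain ⟨Φ, hΦ, hmem, f, hf, hfp⟩ :=
    exists_operator_gtForm d hd hp hlt hl (fun j => (p j).2)
  -- the span of the products of `m` differences in the first `l` of the `n` letters is a copy of
  -- the Specht module
  have hrename : (pairSpan l m l).map (rename (R := ℂ) (Fin.castLE hl)).toLinearMap =
      pairSpan n m l := by
    rw [pairSpan, Submodule.map_span]
    congr 1
    ext g
    constructor
    · rintro ⟨_, ⟨a, b, h, -, rfl⟩, rfl⟩
      refine ⟨_, _, ?_, ?_, rename_pairProd _ a b⟩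
      · rw [← Sum.comp_elim]; exact (Fin.castLE_injective hl).comp h
      · rw [← Sum.comp_elim]; exact fun s => (Sum.elim a b s).2
    · rintro ⟨a, b, h, hs, rfl⟩
      have e : Sum.elim a b = Fin.castLE hl ∘ Sum.elim (fun j => ⟨a j, hs (Sum.inl j)⟩)
          (fun j => ⟨b j, hs (Sum.inr j)⟩) := by
        ext s; cases s <;> rfl
      refine ⟨_, ⟨fun j => ⟨a j, hs (Sum.inl j)⟩, fun j => ⟨b j, hs (Sum.inr j)⟩, ?_,
        fun s => Fin.is_lt _, rfl⟩, rename_pairProd _ _ _⟩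
      rw [e] at h
      exact h.of_comp
  have hcod : ∀ w : (specht l (u.shape l)).toSubmodule,
      Φ (rename (Fin.castLE hl) w.1) ∈ (tensorModel n k).toSubmodule := by
    intro w
    refine pairSpan_le_tensorModel n k n (hmem _ ?_)
    rw [← hrename]
    exact ⟨w.1, by rw [← hspecht]; exact w.2, rfl⟩
  let F : (specht l (u.shape l)).toSubmodule →ₗ[ℂ] (tensorModel n k).toSubmodule :=
    LinearMap.codRestrict _ (Φ ∘ₗ (rename (R := ℂ) (Fin.castLE hl)).toLinearMap ∘ₗ
      (specht l (u.shape l)).toSubmodule.subtype) hcod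
  have hF : ∀ σ w, F ((specht l (u.shape l)).toRepresentation σ w) =
      restrict (tensorModel n k).toRepresentation hl σ (F w) := by
    intro σ w
    refine Subtype.ext ?_
    change Φ (rename (Fin.castLE hl) (rename σ w.1)) =
      permRep n (Equiv.Perm.viaEmbeddingHom (Fin.castLEEmb hl) σ) (Φ (rename (Fin.castLE hl) w.1))
    rw [Equiv.Perm.viaEmbeddingHom_apply, hΦ]
    · change _ = Φ (rename _ (rename _ _))
      rw [rename_rename, rename_rename]
      congr 2
      exact congrArg rename (funext fun i =>
        (σ.viaEmbedding_apply (Fin.castLEEmb hl) i).symm)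
    · intro i hi
      refine σ.viaEmbedding_apply_of_notMem (Fin.castLEEmb hl) i ?_
      rintro ⟨j, rfl⟩
      exact absurd j.2 (not_lt.2 hi)
  rw [← hrename, ← hspecht] at hf
  obtain ⟨w, hw, rfl⟩ := hf
  refine Submodule.mem_iSup_of_mem (F.intertwiningMap_of_isIntertwiningMap _ _ hF) ⟨⟨w, hw⟩, ?_⟩
  exact Subtype.ext hfp

/-- The letters of the second row of a tableau. -/
def secondRow (u : Tableau n μ) : Finset (Fin n) :=
  Finset.univ.filter fun a => (u.cell a).1.1 = 1

/-- An element of `A⁰_{n,k}` is determined by its coefficients at the second rows of the tableaux of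
shape `(n - k, k)`. -/
theorem eq_zero_of_coeffAt_secondRow (hμ : ∀ c ∈ μ.cells, c.1 < 2) (hn : μ.cells.card = n)
    (hk : μ.rowLen 1 = k) {f : MvPolynomial (Fin n) ℂ}
    (hf : f ∈ (tensorModel n k).toSubmodule)
    (h0 : ∀ u : Tableau n μ, coeffAt (secondRow u) f = 0) : f = 0 := by
  classical
  let R : Finset ℕ → Finset (Fin n) := fun S => Finset.univ.filter fun a => (a : ℕ) ∈ S
  have hR : ∀ S ⊆ Finset.range n, (R S).map Fin.valEmbedding = S := by
    intro S hS
    ext x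
    simp only [R, Finset.mem_map, Finset.mem_filter, Finset.mem_univ, true_and,
      Fin.valEmbedding_apply]
    exact ⟨by rintro ⟨a, ha, rfl⟩; exact ha,
      fun hx => ⟨⟨x, Finset.mem_range.1 (hS hx)⟩, hx, rfl⟩⟩
  have hRc : ∀ S ⊆ Finset.range n, (R S).card = S.card := fun S hS => by
    rw [← Finset.card_map Fin.valEmbedding, hR S hS]
  refine formSpace_ext hf.1 (Submodule.zero_mem _) fun I hI => ?_
  have hz : coeffAt I (0 : MvPolynomial (Fin n) ℂ) = 0 := by simp [coeffAt]
  have hIR : R (I.map Fin.valEmbedding) = I := by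
    ext a
    simp [R, ← Fin.ext_iff]
  have hsub : I.map Fin.valEmbedding ⊆ Finset.range n := by
    intro x hx
    obtain ⟨a, -, rfl⟩ := Finset.mem_map.1 hx
    exact Finset.mem_range.2 a.2
  rw [hz, ← hIR]
  refine coeff_eq_zero_of_isBallot (n := n) (k := k) (fun S => coeffAt (R S) f) ?_ ?_ hsub
    (by rw [Finset.card_map, hI])
  · intro J hJ hJk
    rw [← hf.2 (R J) (by rw [hRc J hJ, hJk])]
    have e : Finset.range n \ J = (R J)ᶜ.map Fin.valEmbedding := by
      ext x
      simp only [Finset.mem_sdiff, Finset.mem_range, Finset.mem_map, Finset.mem_compl, R,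
        Finset.mem_filter, Finset.mem_univ, true_and, Fin.valEmbedding_apply]
      exact ⟨fun h => ⟨⟨x, h.1⟩, h.2, rfl⟩, by rintro ⟨a, ha, rfl⟩; exact ⟨a.2, ha⟩⟩
    rw [e, Finset.sum_map]
    refine Finset.sum_congr rfl fun j _ => ?_
    congr 1
    ext a
    simp [R, Fin.ext_iff]
  · intro P hP hPk hPb
    obtain ⟨u, hu⟩ := Tableau.exists_of_ballot hμ hn (P := R P) (by rw [hRc P hP, hPk, hk]) (by
      intro l hl
      refine le_trans (Nat.mul_le_mul_left 2 ?_) (hPb l hl)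
      rw [← Finset.card_map Fin.valEmbedding]
      refine Finset.card_le_card fun x hx => ?_
      obtain ⟨a, ha, rfl⟩ := Finset.mem_map.1 hx
      simpa [R] using ha)
    have : R P = secondRow u := by
      ext a
      rw [← hu]
      simp [secondRow]
    rw [this]
    exact h0 u

theorem card_secondRow (u : Tableau n μ) : (secondRow u).card = μ.rowLen 1 := (u.rowLen_eq 1).symm

/-- The form `F_u` of a tableau `u`, as an element of `A⁰_{n,k}`. -/
def tableauForm (hk : μ.rowLen 1 = k) (u : Tableau n μ) : (tensorModel n k).toSubmodule :=
  ⟨gtForm ((secondRow u).orderEmbOfFin ((card_secondRow u).trans hk)), gtForm_mem_tensorModel _⟩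

theorem range_orderEmbOfFin_secondRow (hk : μ.rowLen 1 = k) (u : Tableau n μ) :
    Set.range ((secondRow u).orderEmbOfFin ((card_secondRow u).trans hk)) = u.row 1 := by
  rw [Finset.range_orderEmbOfFin]
  ext a
  simp [secondRow, Tableau.row]

theorem tableauForm_mem_gtSubspace (hμ : ∀ c ∈ μ.cells, c.1 < 2) (hk : μ.rowLen 1 = k)
    (u : Tableau n μ) :
    tableauForm hk u ∈ gtSubspace (tensorModel n k).toRepresentation u :=
  gtForm_mem_gtSubspace hμ u (OrderEmbedding.strictMono _) (range_orderEmbOfFin_secondRow hk u) hk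

theorem gtForm_ne_zero_of_row (u : Tableau n μ) {p : Fin k → Fin n} (hp : StrictMono p)
    (hrow : Set.range p = u.row 1) : gtForm p ≠ 0 := by
  obtain ⟨i, hi, hinj⟩ := u.exists_above hp.injective fun j => by
    have : p j ∈ u.row 1 := hrow ▸ Set.mem_range_self j
    exact this
  exact gtForm_ne_zero hi hinj

theorem tableauForm_ne_zero (hk : μ.rowLen 1 = k) (u : Tableau n μ) : tableauForm hk u ≠ 0 :=
  fun h => gtForm_ne_zero_of_row u (OrderEmbedding.strictMono _)
    (range_orderEmbOfFin_secondRow hk u) (congrArg Subtype.val h)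

/-- The eigenvalues of the operators `swapSum` on the Gelfand–Tsetlin subspace of `u`. -/
def gtCharacter (u : Tableau n μ) (l : Fin (n + 1)) : ℂ :=
  swapEigenvalue l ((u.shape l).rowLen 1)

theorem gtCharacter_injective (hμ : ∀ c ∈ μ.cells, c.1 < 2) :
    Function.Injective (gtCharacter (n := n) (μ := μ)) := by
  intro u v h
  refine Tableau.eq_of_rowLen_shape_eq hμ fun l hl => ?_
  exact swapEigenvalue_injOn (u.two_mul_rowLen_shape_le hμ hl) (v.two_mul_rowLen_shape_le hμ hl)
    (congrFun h ⟨l, Nat.lt_succ_of_le hl⟩)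

theorem linearIndependent_tableauForm (hμ : ∀ c ∈ μ.cells, c.1 < 2) (hk : μ.rowLen 1 = k) :
    LinearIndependent ℂ (tableauForm (n := n) hk) :=
  linearIndependent_of_joint_eigenvectors (tableauForm_ne_zero hk)
    (fun l : Fin (n + 1) => swapSum (tensorModel n k).toRepresentation (Nat.le_of_lt_succ l.2))
    gtCharacter
    (fun u _ => swapSum_of_mem_gtSubspace hμ _ (tableauForm_mem_gtSubspace hμ hk u) _)
    (gtCharacter_injective hμ)

/-- By `eq_zero_of_coeffAt_secondRow`, the dimension of `A⁰_{n,k}` is at most the number of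
tableaux, which is the number of the linearly independent elements `F_u`. -/
theorem span_tableauForm (hμ : ∀ c ∈ μ.cells, c.1 < 2) (hn : μ.cells.card = n)
    (hk : μ.rowLen 1 = k) : ⊤ ≤ Submodule.span ℂ (Set.range (tableauForm (n := n) hk)) := by
  have := Fintype.ofFinite (Tableau n μ)
  let C : (tensorModel n k).toSubmodule →ₗ[ℂ] (Tableau n μ → ℂ) :=
    LinearMap.pi fun u => lcoeff ℂ (sqfreeExp (secondRow u)) ∘ₗ
      (tensorModel n k).toSubmodule.subtype
  have hC : Function.Injective C := by
    rw [← LinearMap.ker_eq_bot, LinearMap.ker_eq_bot']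
    intro f hf
    exact Subtype.ext (eq_zero_of_coeffAt_secondRow hμ hn hk f.2 fun u => congrFun hf u)
  have hfin : FiniteDimensional ℂ (tensorModel n k).toSubmodule :=
    FiniteDimensional.of_injective C hC
  have hle := LinearMap.finrank_le_finrank_of_injective hC
  rw [Module.finrank_pi] at hle
  have hli := linearIndependent_tableauForm (n := n) hμ hk
  exact (hli.span_eq_top_of_card_eq_finrank' (le_antisymm hli.fintype_card_le_finrank hle)).ge

/-- The basis of `A⁰_{n,k}` formed by the `F_u`. -/
def tableauBasis (hμ : ∀ c ∈ μ.cells, c.1 < 2) (hn : μ.cells.card = n) (hk : μ.rowLen 1 = k) :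
    Module.Basis (Tableau n μ) ℂ (tensorModel n k).toSubmodule :=
  Module.Basis.mk (linearIndependent_tableauForm hμ hk) (span_tableauForm hμ hn hk)

theorem mem_gtSubspace_iff (hμ : ∀ c ∈ μ.cells, c.1 < 2) (hk : μ.rowLen 1 = k)
    (u : Tableau n μ) {f : (tensorModel n k).toSubmodule} :
    f ∈ gtSubspace (tensorModel n k).toRepresentation u ↔ ∃ c : ℂ, f = c • tableauForm hk u := by
  constructor
  · intro hf
    have h := eq_smul_of_joint_eigenvector (tableauBasis hμ u.card_cells hk)
      (fun l : Fin (n + 1) => swapSum (tensorModel n k).toRepresentation (Nat.le_of_lt_succ l.2))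
      gtCharacter
      (fun v _ => swapSum_of_mem_gtSubspace hμ _ (by
        rw [tableauBasis, Module.Basis.mk_apply]; exact tableauForm_mem_gtSubspace hμ hk v) _)
      (gtCharacter_injective hμ) (i := u)
      (fun l => swapSum_of_mem_gtSubspace hμ _ hf (Nat.le_of_lt_succ l.2))
    exact ⟨(tableauBasis hμ u.card_cells hk).repr f u, h.trans (by
      rw [tableauBasis, Module.Basis.mk_apply])⟩
  · rintro ⟨c, rfl⟩
    exact Submodule.smul_mem _ c (tableauForm_mem_gtSubspace hμ hk u)

end GelfandTsetlin

end TwoRow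

end

theorem mainTheorem3 {n k : ℕ} {μ : YoungDiagram} (hμ : ∀ c ∈ μ.cells, c.1 < 2)
    (u : TwoRow.Tableau n μ) (p : Fin k → Fin n) (hp : StrictMono p)
    (hrow : Set.range p = u.row 1) :
    TwoRow.gtForm p ≠ 0 ∧
    (TwoRow.gtSubspace (TwoRow.tensorModel n k).toRepresentation u).map
        (TwoRow.tensorModel n k).toSubmodule.subtype = Submodule.span ℂ {TwoRow.gtForm p} ∧
    (∃ h : Module.Basis (TwoRow.Tableau n μ) ℂ (TwoRow.tensorModel n k).toSubmodule,
      TwoRow.IsGelfandTsetlinBasis (TwoRow.tensorModel n k).toRepresentation h ∧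
      ∀ v : TwoRow.Tableau n μ, TwoRow.formNormSq k (h v).1 = 1) ∧
    ∀ h : Module.Basis (TwoRow.Tableau n μ) ℂ (TwoRow.tensorModel n k).toSubmodule,
      TwoRow.IsGelfandTsetlinBasis (TwoRow.tensorModel n k).toRepresentation h →
      ∃ c : ℂ, c ≠ 0 ∧ (h u).1 = c • TwoRow.gtForm p ∧
        (TwoRow.formNormSq k (h u).1 = 1 →
          ‖c‖ ^ 2 * TwoRow.formNormSq k (TwoRow.gtForm p) = 1) := by
  classical
  have hmem : ∀ a, a ∈ TwoRow.secondRow u ↔ a ∈ Set.range p := by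
    intro a
    rw [hrow]
    simp [TwoRow.secondRow, TwoRow.Tableau.row]
  have hsec : TwoRow.secondRow u = Finset.univ.map ⟨p, hp.injective⟩ := by
    ext a
    simp [hmem]
  have hk : μ.rowLen 1 = k := by
    rw [← TwoRow.card_secondRow u, hsec]
    simp
  have hform : (TwoRow.tableauForm hk u).1 = TwoRow.gtForm p :=
    congrArg TwoRow.gtForm (Finset.orderEmbOfFin_unique _
      (fun j => (hmem _).2 (Set.mem_range_self j)) hp).symm
  refine ⟨TwoRow.gtForm_ne_zero_of_row u hp hrow, ?_, ?_, ?_⟩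
  · ext f
    rw [Submodule.mem_span_singleton]
    constructor
    · rintro ⟨g, hg, rfl⟩
      obtain ⟨c, rfl⟩ := (TwoRow.mem_gtSubspace_iff hμ hk u).1 hg
      exact ⟨c, by rw [← hform]; rfl⟩
    · rintro ⟨c, rfl⟩
      exact ⟨c • TwoRow.tableauForm hk u, (TwoRow.mem_gtSubspace_iff hμ hk u).2 ⟨c, rfl⟩,
        by rw [← hform]; rfl⟩
  · have hpos : ∀ v : TwoRow.Tableau n μ,
        0 < TwoRow.formNormSq k (TwoRow.tableauForm hk v).1 := fun v =>
      TwoRow.formNormSq_pos (TwoRow.tableauForm hk v).2.1 fun h =>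
        TwoRow.tableauForm_ne_zero hk v (Subtype.ext h)
    let w : TwoRow.Tableau n μ → ℂ := fun v =>
      ((√(TwoRow.formNormSq k (TwoRow.tableauForm hk v).1))⁻¹ : ℝ)
    have hw : ∀ v, IsUnit (w v) := fun v => by
      refine isUnit_iff_ne_zero.2 (Complex.ofReal_ne_zero.2 (inv_ne_zero ?_))
      exact (Real.sqrt_pos.2 (hpos v)).ne'
    have happ : ∀ v, (TwoRow.tableauBasis hμ u.card_cells hk).isUnitSMul hw v =
        w v • TwoRow.tableauForm hk v := fun v => by
      rw [Module.Basis.isUnitSMul_apply, TwoRow.tableauBasis, Module.Basis.mk_apply]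
    refine ⟨(TwoRow.tableauBasis hμ u.card_cells hk).isUnitSMul hw, fun v => ?_, fun v => ?_⟩
    · exact (TwoRow.mem_gtSubspace_iff hμ hk v).2 ⟨w v, happ v⟩
    · rw [happ, Submodule.coe_smul, TwoRow.formNormSq_smul]
      simp only [w]
      rw [Complex.norm_real, Real.norm_eq_abs, sq_abs, inv_pow, Real.sq_sqrt (hpos v).le,
        inv_mul_cancel₀ (hpos v).ne']
  · intro h hh
    obtain ⟨c, hc⟩ := (TwoRow.mem_gtSubspace_iff hμ hk u).1 (hh u)
    have hc' : (h u).1 = c • TwoRow.gtForm p := by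
      rw [hc, ← hform]; rfl
    refine ⟨c, ?_, hc', fun h1 => ?_⟩
    · rintro rfl
      exact h.ne_zero u (by rw [hc, zero_smul])
    · rw [← TwoRow.formNormSq_smul, ← hc', h1]
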